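/- **Setting.** Let $d\ge 1$, $D\subset\mathbf R^d$, $\delta>0$, and let $U=[D]_\delta=\{t+u: t\in D,\ \|u\|<\delta\}$. Let $\psi(x)=(2\pi x^2)^{-1/2}e^{-x^2/2}$. For $t\in\mathbf R^d$ and $\zeta>0$ put $I_{t,\zeta}=\prod_{i=1}^d[t_i,t_i+\zeta)$ and $\bar I_{t,\zeta}=\prod_{i=1}^d[t_i,t_i+\zeta]$. Let $0<\alpha\le2$, let $L$ be slowly varying at $0$, and let $\Delta_c=\min\{x>0: x^\alpha L(x)=(2c^2)^{-1}\}$, where this minimum is assumed to exist for all large $c$ and $\Delta_c\to0$ as $c\to\infty$. For $t\in U$ let $r_t:\mathbf S^{d-1}\to(0,\infty)$ be continuous, with $\sup_{t\in U,\,v\in\mathbf S^{d-1}}r_t(v)<\infty$ and $\sup_v|r_t(v)-r_u(v)|\to0$ as $u\to t$, uniformly in $t\in U$. Write $\sigma_t(u)=\|u\|^\alpha r_t(u/\|u\|)$ for $u\neq 0$ and $\sigma_t(0)=0$. For $t\in U$ let $\{W_t(u):u\in[0,\infty)^d\}$ be a continuous Gaussian random field with $W_t(0)=0$, $E[W_t(u)]=-\sigma_t(u)/2$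 and $\mathrm{Cov}(W_t(u),W_t(v))=[\sigma_t(u)+\sigma_t(v)-\sigma_t(u-v)]/2$. For large $c$ let $X_c$ be a random field whose domain contains $U$, with $E X_c(t)=0$ and $E X_c(t)^2=1$ for $t\in U$. **Conditions.** As $c\to\infty$, uniformly over $t\in U$ such that all the points of the field that occur in the condition belong to $U$: * (C) $E[X_c(t)X_c(t+u)]=1-(1+o(1))\,\sigma_t(u)\,L(\|u\|)$ for $u=\Delta_c v$, uniformly over $v$ in compact subsets of $(0,\infty)^d$. * (A1) $P\{X_c(t)>c-y/c\}\sim\psi(c-y/c)$, uniformly over nonnegative, bounded values of $y$. * (A2) For all $a>0$ and positive integers $m$, the conditional distribution of $\{c[X_c(t+ak\Delta_c)-X_c(t)]: k\in\mathbf Z^d,\ 0\le k_i<m\}$ given $X_c(t)=c-y/c$ converges weakly to the distribution of $\{W_t(ak): 0\le k_i<m\}$, uniformly over positive, bounded values of $y$. (For each bounded continuous test function, the values of $c-y/c$ in a null set of the law of $X_c(t)$ are disregarded.) * (A3) For all $u\in[0,\infty)^d$ and $\gamma>0$ there is a positive function $h$ with $\lim_{y\to\infty}h(y)=0$ such that,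 for every $y>0$ and all large $c$, $P\{X_c(t+u\Delta_c)>c-\gamma/c,\ X_c(t)\le c-y/c\}\le h(y)\psi(c)$. * (A4) There are nonincreasing functions $N_a\ge0$ on $(0,\infty)$ and constants $\gamma_a>0$ $(a>0)$ with $\gamma_a\to0$ and $N_a(\gamma_a)+\int_1^\infty\omega^sN_a(\gamma_a+\omega)\,d\omega=o(a^d)$ as $a\to0$, for every $s>0$, such that for every $a>0$ and all large $c$, $P\{\sup_{u\in[0,a]^d}X_c(t+u\Delta_c)>c,\ X_c(t)\le c-\gamma/c\}\le N_a(\gamma)\psi(c)$ for all $\gamma_a\le\gamma\le c$. **Theorem 2.4.** Let $K>0$ and assume (C) and (A1)–(A4). Then $$H_K(t)=\int_0^\infty e^y\,P\Big\{\sup_{u\in[0,K]^d}W_t(u)>y\Big\}\,dy$$ is finite for every $t\in U$ and uniformly continuous in $t\in U$, and, as $c\to\infty$, $$P\Big\{\sup_{u\in I_{t,K\Delta_c}}X_c(u)>c\Big\}\sim\psi(c)\,[1+H_K(t)]$$ uniformly over all $t\in U$ with $\bar I_{t,K\Delta_c}\subset U$. In particular this holds uniformly over $t\in[D]_{\delta'}$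 for every $0<\delta'<\delta$. (If an event involving a supremum is not measurable, $P$ denotes outer probability.) -/

import Mathlib

open MeasureTheory ProbabilityTheory Filter Topology Set

noncomputable section

/-- `ψ(x) = (2πx²)^{-1/2} exp(-x²/2)`. -/
def psi (x : ℝ) : ℝ := (Real.sqrt (2 * Real.pi * x ^ 2))⁻¹ * Real.exp (-x ^ 2 / 2)

/-- The half-open cube `I_{t,ζ} = ∏ [t_i, t_i + ζ)`. -/
def cubeI {d : ℕ} (t : EuclideanSpace ℝ (Fin d)) (ζ : ℝ) : Set (EuclideanSpace ℝ (Fin d)) :=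
  {u | ∀ i, t i ≤ u i ∧ u i < t i + ζ}

/-- The closed cube `∏ [t_i, t_i + ζ]`. -/
def closedCube {d : ℕ} (t : EuclideanSpace ℝ (Fin d)) (ζ : ℝ) : Set (EuclideanSpace ℝ (Fin d)) :=
  {u | ∀ i, t i ≤ u i ∧ u i ≤ t i + ζ}

/-- The orthant `[0, ∞)^d`. -/
def orthant (d : ℕ) : Set (EuclideanSpace ℝ (Fin d)) := {u | ∀ i, 0 ≤ u i}

/-- The point `a k ∈ ℝ^d` for a multi-index `k` with `0 ≤ k_i < m`. -/
def gridPt {d m : ℕ} (a : ℝ) (k : Fin d → Fin m) : EuclideanSpace ℝ (Fin d) :=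
  WithLp.toLp 2 (fun i => a * ((k i : ℕ) : ℝ))

/-- `L` is (measurable, positive near `0` and) slowly varying at `0`. -/
structure SlowlyVaryingAtZero (L : ℝ → ℝ) : Prop where
  measurable : Measurable ((Ioi (0 : ℝ)).domRestrict L)
  pos : ∀ᶠ x in 𝓝[>] (0 : ℝ), 0 < L x
  ratio : ∀ l : ℝ, 0 < l → Tendsto (fun x => L (l * x) / L x) (𝓝[>] (0 : ℝ)) (𝓝 1)

/-- The set `{x > 0 : x^α L(x) = (2c²)⁻¹}` whose minimum is `Δ_c`. -/
def levelSet (α : ℝ) (L : ℝ → ℝ) (c : ℝ) : Set ℝ :=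
  {x | 0 < x ∧ x ^ α * L x = (2 * c ^ 2)⁻¹}

/-- `Δ_c = min {x > 0 : x^α L(x) = (2c²)⁻¹}` (the infimum, when the minimum does not exist). -/
def Delta (α : ℝ) (L : ℝ → ℝ) (c : ℝ) : ℝ := sInf (levelSet α L c)

/-- For all large `c` the minimum defining `Δ_c` exists, and `Δ_c → 0` as `c → ∞`. -/
structure DeltaWellDefined (α : ℝ) (L : ℝ → ℝ) : Prop where
  isLeast : ∀ᶠ c in atTop, IsLeast (levelSet α L c) (Delta α L c)
  tendsto_zero : Tendsto (Delta α L) atTop (𝓝 0)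

/-- `‖u‖^α r_t(u/‖u‖)` (which is `0` at `u = 0` when `α > 0`). -/
def increVar {d : ℕ} (α : ℝ) (r : EuclideanSpace ℝ (Fin d) → EuclideanSpace ℝ (Fin d) → ℝ)
    (t u : EuclideanSpace ℝ (Fin d)) : ℝ :=
  ‖u‖ ^ α * r t (‖u‖⁻¹ • u)

/-- The functions `r_t : S^{d-1} → (0, ∞)`, `t ∈ U`, are continuous, bounded uniformly in `t ∈ U`,
and `sup_v |r_t(v) - r_u(v)| → 0` as `u → t`, uniformly in `t ∈ U`. -/
structure IsRFamily {d : ℕ} (U : Set (EuclideanSpace ℝ (Fin d)))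
    (r : EuclideanSpace ℝ (Fin d) → EuclideanSpace ℝ (Fin d) → ℝ) : Prop where
  pos : ∀ t ∈ U, ∀ v ∈ Metric.sphere (0 : EuclideanSpace ℝ (Fin d)) 1, 0 < r t v
  cont : ∀ t ∈ U, ContinuousOn (r t) (Metric.sphere 0 1)
  unif : ∀ ε > 0, ∃ η > 0, ∀ t ∈ U, ∀ u ∈ U, ‖u - t‖ < η →
    ∀ v ∈ Metric.sphere (0 : EuclideanSpace ℝ (Fin d)) 1, |r t v - r u v| ≤ ε
  bdd : ∃ M : ℝ, ∀ t ∈ U, ∀ v ∈ Metric.sphere (0 : EuclideanSpace ℝ (Fin d)) 1, r t v ≤ M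

/-- For each `t ∈ U`, `W_t` is an (almost surely) continuous Gaussian random field on `[0, ∞)^d`
with `W_t(0) = 0` and the prescribed mean and covariance functions.  Only the values `W t u` with
`u ∈ [0, ∞)^d` matter. -/
structure IsLimitField {d : ℕ} {Ω' : Type*} [MeasurableSpace Ω'] (Q : Measure Ω')
    (U : Set (EuclideanSpace ℝ (Fin d))) (α : ℝ)
    (r : EuclideanSpace ℝ (Fin d) → EuclideanSpace ℝ (Fin d) → ℝ)
    (W : EuclideanSpace ℝ (Fin d) → EuclideanSpace ℝ (Fin d) → Ω' → ℝ) : Prop where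
  gaussian : ∀ t ∈ U, IsGaussianProcess (fun u : orthant d => W t u) Q
  cont : ∀ t ∈ U, ∀ᵐ ω ∂Q, ContinuousOn (fun u => W t u ω) (orthant d)
  zero : ∀ t ∈ U, ∀ᵐ ω ∂Q, W t 0 ω = 0
  mean : ∀ t ∈ U, ∀ u ∈ orthant d, ∫ ω, W t u ω ∂Q = -increVar α r t u / 2
  cov : ∀ t ∈ U, ∀ u ∈ orthant d, ∀ v ∈ orthant d,
    covariance (W t u) (W t v) Q =
      (increVar α r t u + increVar α r t v - increVar α r t (u - v)) / 2

/-- `H_K(t) = ∫_0^∞ e^y P{sup_{[0,K]^d} W_t > y} dy`, as an element of `[0, ∞]`. -/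
def HK {d : ℕ} {Ω' : Type*} [MeasurableSpace Ω'] (Q : Measure Ω')
    (W : EuclideanSpace ℝ (Fin d) → EuclideanSpace ℝ (Fin d) → Ω' → ℝ) (K : ℝ)
    (t : EuclideanSpace ℝ (Fin d)) : ENNReal :=
  ∫⁻ y in Ioi (0 : ℝ), ENNReal.ofReal (Real.exp y) *
    Q {ω | (y : EReal) < ⨆ u ∈ closedCube (0 : EuclideanSpace ℝ (Fin d)) K, (W t u ω : EReal)}

variable {d : ℕ} {Ω : Type*} [MeasurableSpace Ω]

/-- For all large `c`, `X_c` is a random field on `U` with mean `0` and variance `1`. -/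
def IsNormalizedField (P : Measure Ω) (U : Set (EuclideanSpace ℝ (Fin d)))
    (X : ℝ → EuclideanSpace ℝ (Fin d) → Ω → ℝ) : Prop :=
  ∀ᶠ c in atTop, ∀ t ∈ U, Measurable (X c t) ∧ ∫ ω, X c t ω ∂P = 0 ∧ ∫ ω, (X c t ω) ^ 2 ∂P = 1

/-- Condition (C): `E[X_c(t) X_c(t+u)] = 1 - (1 + o(1)) ‖u‖^α L(‖u‖) r_t(u/‖u‖)` with
`u = Δ_c v`, uniformly in `t` and in `v` in compact subsets of `(0, ∞)^d`. -/
def CondC (P : Measure Ω) (U : Set (EuclideanSpace ℝ (Fin d)))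
    (X : ℝ → EuclideanSpace ℝ (Fin d) → Ω → ℝ) (α : ℝ) (L : ℝ → ℝ)
    (r : EuclideanSpace ℝ (Fin d) → EuclideanSpace ℝ (Fin d) → ℝ) : Prop :=
  ∀ S : Set (EuclideanSpace ℝ (Fin d)), IsCompact S → S ⊆ {v | ∀ i, 0 < v i} →
    ∀ ε > 0, ∀ᶠ c in atTop, ∀ t ∈ U, ∀ v ∈ S, t + Delta α L c • v ∈ U →
      |(1 - ∫ ω, X c t ω * X c (t + Delta α L c • v) ω ∂P)
          - increVar α r t (Delta α L c • v) * L ‖Delta α L c • v‖|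
        ≤ ε * (increVar α r t (Delta α L c • v) * L ‖Delta α L c • v‖)

/-- Condition (A1): `P{X_c(t) > c - y/c} ~ ψ(c - y/c)` uniformly in `t` and in `y` in bounded
subsets of `[0, ∞)`. -/
def CondA1 (P : Measure Ω) (U : Set (EuclideanSpace ℝ (Fin d)))
    (X : ℝ → EuclideanSpace ℝ (Fin d) → Ω → ℝ) : Prop :=
  ∀ Y > 0, ∀ ε > 0, ∀ᶠ c in atTop, ∀ t ∈ U, ∀ y ∈ Icc (0 : ℝ) Y,
    |P.real {ω | c - y / c < X c t ω} - psi (c - y / c)| ≤ ε * psi (c - y / c)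

/-- Condition (A2): the conditional law of `{c [X_c(t + a k Δ_c) - X_c(t)] : 0 ≤ k_i < m}` given
`X_c(t) = c - y/c` converges weakly to the law of `{W_t(a k) : 0 ≤ k_i < m}`, uniformly in `t` and
in `y` in bounded subsets of `(0, ∞)`.  Since the conditional law is determined only up to null sets
of the law of `X_c(t)`, the values `x = c - y/c` are taken outside such a null set. -/
def CondA2 {Ω' : Type*} [MeasurableSpace Ω'] (P : Measure Ω) [IsFiniteMeasure P] (Q : Measure Ω')
    (U : Set (EuclideanSpace ℝ (Fin d)))
    (X : ℝ → EuclideanSpace ℝ (Fin d) → Ω → ℝ) (α : ℝ) (L : ℝ → ℝ)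
    (W : EuclideanSpace ℝ (Fin d) → EuclideanSpace ℝ (Fin d) → Ω' → ℝ) : Prop :=
  ∀ a > 0, ∀ m : ℕ, 0 < m → ∀ Y > 0, ∀ f : BoundedContinuousFunction ((Fin d → Fin m) → ℝ) ℝ,
    ∀ ε > 0, ∀ᶠ c in atTop, ∀ t ∈ U,
      (∀ k : Fin d → Fin m, t + Delta α L c • gridPt a k ∈ U) →
      ∀ᵐ x ∂(P.map (X c t)), ∀ y ∈ Ioc (0 : ℝ) Y, x = c - y / c →
        |(∫ z, f z ∂(condDistrib
              (fun ω (k : Fin d → Fin m) => c * (X c (t + Delta α L c • gridPt a k) ω - X c t ω))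
              (X c t) P x))
            - ∫ ω', f (fun k => W t (gridPt a k) ω') ∂Q| ≤ ε

/-- Condition (A3): for each `u ≥ 0` and `γ > 0` there is a positive function `h` with
`h(y) → 0` as `y → ∞` and `P{X_c(t + uΔ_c) > c - γ/c, X_c(t) ≤ c - y/c} ≤ h(y) ψ(c)` for large `c`,
uniformly in `t`. -/
def CondA3 (P : Measure Ω) (U : Set (EuclideanSpace ℝ (Fin d)))
    (X : ℝ → EuclideanSpace ℝ (Fin d) → Ω → ℝ) (α : ℝ) (L : ℝ → ℝ) : Prop :=
  ∀ u ∈ orthant d, ∀ γ > 0, ∃ h : ℝ → ℝ, (∀ y, 0 < h y) ∧ Tendsto h atTop (𝓝 0) ∧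
    ∀ y > 0, ∀ᶠ c in atTop, ∀ t ∈ U, t + Delta α L c • u ∈ U →
      P.real {ω | c - γ / c < X c (t + Delta α L c • u) ω ∧ X c t ω ≤ c - y / c} ≤ h y * psi c

/-- Condition (A4): there are nonincreasing functions `N_a ≥ 0` on `(0, ∞)` and positive constants
`γ_a → 0` with `N_a(γ_a) + ∫_1^∞ w^s N_a(γ_a + w) dw = o(a^d)` as `a → 0` for all `s > 0`, and
`P{sup_{0 ≤ u ≤ a} X_c(t + uΔ_c) > c, X_c(t) ≤ c - γ/c} ≤ N_a(γ) ψ(c)` for `γ_a ≤ γ ≤ c`, for large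
`c`, uniformly in `t`. -/
def CondA4 (P : Measure Ω) (U : Set (EuclideanSpace ℝ (Fin d)))
    (X : ℝ → EuclideanSpace ℝ (Fin d) → Ω → ℝ) (α : ℝ) (L : ℝ → ℝ) : Prop :=
  ∃ (N : ℝ → ℝ → ℝ) (g : ℝ → ℝ),
    (∀ a > 0, AntitoneOn (N a) (Ioi 0) ∧ (∀ x > 0, 0 ≤ N a x) ∧ 0 < g a) ∧
    Tendsto g (𝓝[>] 0) (𝓝 0) ∧
    (∀ s > 0,
      (∀ᶠ a in 𝓝[>] (0 : ℝ), IntegrableOn (fun w => w ^ s * N a (g a + w)) (Ioi 1)) ∧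
      (fun a => N a (g a) + ∫ w in Ioi (1 : ℝ), w ^ s * N a (g a + w))
        =o[𝓝[>] (0 : ℝ)] (fun a : ℝ => a ^ d)) ∧
    ∀ a > 0, ∀ᶠ c in atTop, ∀ t ∈ U, closedCube t (a * Delta α L c) ⊆ U →
      ∀ γ : ℝ, g a ≤ γ → γ ≤ c →
        P.real {ω | ((c : EReal) < ⨆ u ∈ closedCube (0 : EuclideanSpace ℝ (Fin d)) a,
              (X c (t + Delta α L c • u) ω : EReal))
            ∧ X c t ω ≤ c - γ / c} ≤ N a γ * psi c

end

/-! Write X_c(t) = c - y/c. Since ψ(c - y/c)/ψ(c) → e^y, (A1) says that c(c - X_c(t)) has asymptotic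
density e^y relative to ψ(c), and by (A2) the rescaled increments over a finite grid, given y,
behave like W_t. So an exceedance of c on the grid has probability about ψ(c)(1 + ∫ e^y P{max W_t >
y} dy): the 1 is the event X_c(t) > c, and the integral collects the starting levels below c. This
integral over the grid of mesh K/m is `gridH`; slicing the values of y turns the heuristic into the
bounds `eventually_le_prob_grid` and `eventually_prob_grid_le`, where (A3) disposes of large y in
the upper bound.

The grid lies in the cube, so the lower bound passes to the cube at once. Conversely, if the field
exceeds c in the cube, then either some grid point exceeds c - γ/c, or one of the m^d cells has an
exceedance although its corner is at most c - γ/c. The first alternative costs a factor e^γ, the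
second an error m^d N_a(γ_a) ψ(c) with a = K/m, and (A4) makes both harmless as m → ∞.

Both bounds concern the same probability, so X_c can be eliminated: `HK_le_of_CondA4` bounds H_K by
e^γ (1 + gridH) + m^d N_a(γ_a) - 1, while gridH ≤ H_K is trivial. Hence H_K is finite and is a
uniform limit of the functions gridH. Each of these is E exp(max) - 1 for a Gaussian vector, a
continuous function of a covariance matrix which stays in a compact set and is uniformly continuous
in t. So H_K is uniformly continuous, and the same sandwich yields the uniform asymptotics. -/

/-! ### Exponential moments of the maximum of a Gaussian vector. -/

section GaussianMax

variable {ι : Type*} [Fintype ι] [DecidableEq ι]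

/-- The Gaussian law on `ℝ^ι` with covariance `S` and mean `-S i i / 2`. -/
noncomputable def gaussLaw (S : ι → ι → ℝ) : Measure (EuclideanSpace ℝ ι) :=
  multivariateGaussian (WithLp.toLp 2 fun i => -S i i / 2) (Matrix.of S)

instance (S : ι → ι → ℝ) : IsProbabilityMeasure (gaussLaw S) := by
  unfold gaussLaw; infer_instance

theorem gaussLaw_integrable_exp {S : ι → ι → ℝ} (hS : (Matrix.of S).PosSemidef) (i : ι) (p : ℝ) :
    Integrable (fun x : EuclideanSpace ℝ ι => Real.exp (p * x i)) (gaussLaw S) := by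
  have h := measurePreserving_eval_multivariateGaussian
    (μ := WithLp.toLp 2 fun i => -S i i / 2) hS (i := i)
  exact h.integrable_comp_of_integrable (integrable_exp_mul_gaussianReal p)

theorem gaussLaw_integral_exp {S : ι → ι → ℝ} (hS : (Matrix.of S).PosSemidef) (i : ι) (p : ℝ) :
    ∫ x : EuclideanSpace ℝ ι, Real.exp (p * x i) ∂(gaussLaw S)
      = Real.exp ((p ^ 2 - p) * S i i / 2) := by
  have h := measurePreserving_eval_multivariateGaussian
    (μ := WithLp.toLp 2 fun i => -S i i / 2) hS (i := i)
  have h2 := mgf_gaussianReal h.map_eq p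
  rw [mgf] at h2
  rw [gaussLaw, h2]
  have h3 : 0 ≤ S i i := hS.diag_nonneg (i := i)
  simp only [Matrix.of_apply, Real.coe_toNNReal _ h3]
  congr 1; ring

omit [DecidableEq ι] in
theorem isClosed_posSemidef_of : IsClosed {S : ι → ι → ℝ | (Matrix.of S).PosSemidef} := by
  have : {S : ι → ι → ℝ | (Matrix.of S).PosSemidef} =
      {S | ∀ i j, S i j = S j i} ∩ ⋂ x : ι → ℝ, {S | 0 ≤ ∑ i, x i * ∑ j, S i j * x j} := by
    ext S
    simp only [Matrix.posSemidef_iff_dotProduct_mulVec, mem_ofPred_eq, mem_inter_iff, mem_iInter]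
    refine and_congr ?_ ?_
    · rw [Matrix.IsHermitian, ← Matrix.ext_iff]
      simp only [Matrix.conjTranspose_apply, Matrix.of_apply, star_trivial]
      exact ⟨fun h i j => (h j i), fun h i j => h j i⟩
    · simp [dotProduct, Matrix.mulVec]
  rw [this]
  refine IsClosed.inter ?_ (isClosed_iInter fun x => ?_)
  · simp only [ofPred_forall]
    refine isClosed_iInter fun i => isClosed_iInter fun j => isClosed_eq ?_ ?_ <;> fun_prop
  · exact isClosed_le (by fun_prop) (by fun_prop)

omit [DecidableEq ι] in
theorem isCompact_posSemidef_box (B : ℝ) :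
    IsCompact {S : ι → ι → ℝ | (Matrix.of S).PosSemidef ∧ ∀ i j, S i j ∈ Icc (-B) B} := by
  have h : IsCompact (Set.pi univ fun _ : ι => Set.pi univ fun _ : ι => Icc (-B) B) :=
    isCompact_univ_pi fun _ => isCompact_univ_pi fun _ => isCompact_Icc (a := -B) (b := B)
  convert h.inter_left (isClosed_posSemidef_of (ι := ι)) using 1
  ext S; simp only [mem_ofPred_eq, mem_inter_iff, mem_univ_pi]

/-- Lévy's continuity theorem: the characteristic function is explicit and continuous in S. Singular
S are included, so densities are of no use here. -/
theorem continuousOn_integral_gaussLaw (f : BoundedContinuousFunction (EuclideanSpace ℝ ι) ℝ) :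
    ContinuousOn (fun S : ι → ι → ℝ => ∫ x, f x ∂(gaussLaw S)) {S | (Matrix.of S).PosSemidef} := by
  intro S hS
  refine tendsto_of_seq_tendsto fun u hu => ?_
  rw [tendsto_nhdsWithin_iff] at hu
  obtain ⟨hu1, N, hN⟩ := hu.imp_right eventually_atTop.1
  -- Dropping the first N terms leaves only positive semidefinite matrices, for which the formula
  -- for the characteristic function holds.
  rw [← tendsto_add_atTop_iff_nat N]
  have hu1 := (tendsto_add_atTop_iff_nat N).2 hu1
  let ν : ℕ → ProbabilityMeasure (EuclideanSpace ℝ ι) := fun n => ⟨gaussLaw (u (n + N)), inferInstance⟩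
  let ν₀ : ProbabilityMeasure (EuclideanSpace ℝ ι) := ⟨gaussLaw S, inferInstance⟩
  have key : Tendsto ν atTop (𝓝 ν₀) := by
    refine ProbabilityMeasure.tendsto_iff_tendsto_charFun.2 fun x => ?_
    have e0 : charFun (ν₀ : Measure (EuclideanSpace ℝ ι)) x = _ := charFun_multivariateGaussian hS x
    have e1 : ∀ n, charFun (ν n : Measure (EuclideanSpace ℝ ι)) x = _ := fun n =>
      charFun_multivariateGaussian (hN (n + N) (by omega)) x
    simp only [e0, e1]
    have hc : Continuous fun S : ι → ι → ℝ =>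
        Complex.exp ((inner ℝ x (WithLp.toLp 2 fun i => -S i i / 2) : ℝ) * Complex.I
          - ((x.ofLp ⬝ᵥ (Matrix.of S).mulVec x.ofLp : ℝ) : ℂ) / 2) := by
      simp only [PiLp.inner_apply, dotProduct, Matrix.mulVec, Matrix.of_apply]
      simp only [RCLike.inner_apply, conj_trivial]
      fun_prop
    have := (hc.tendsto S).comp hu1
    simpa [Function.comp_def] using this
  exact (ProbabilityMeasure.tendsto_iff_forall_integral_tendsto.1 key) f

variable [Nonempty ι]

/-- The largest coordinate. -/
noncomputable def maxCoord (x : ι → ℝ) : ℝ := Finset.univ.sup' Finset.univ_nonempty x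

omit [DecidableEq ι] in
theorem lt_maxCoord {x : ι → ℝ} {y : ℝ} : y < maxCoord x ↔ ∃ k, y < x k := by
  simp [maxCoord, Finset.lt_sup'_iff]

omit [DecidableEq ι] in
theorem continuous_maxCoord : Continuous (maxCoord : (ι → ℝ) → ℝ) := by
  unfold maxCoord
  exact Continuous.finset_sup'_apply _ fun i _ => continuous_apply i

omit [DecidableEq ι] in
theorem exp_mul_maxCoord_le (x : ι → ℝ) (p : ℝ) :
    Real.exp (p * maxCoord x) ≤ ∑ i, Real.exp (p * x i) := by
  obtain ⟨i, -, hi⟩ := Finset.exists_mem_eq_sup' (Finset.univ_nonempty (α := ι)) x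
  rw [maxCoord, hi]
  exact Finset.single_le_sum (f := fun i => Real.exp (p * x i)) (fun _ _ => (Real.exp_pos _).le)
    (Finset.mem_univ i)

/-- `E exp(max_i x_i)` under `gaussLaw S`. -/
noncomputable def expMax (S : ι → ι → ℝ) : ℝ :=
  ∫ x : EuclideanSpace ℝ ι, Real.exp (maxCoord x.ofLp) ∂(gaussLaw S)

theorem integrable_exp_mul_maxCoord {S : ι → ι → ℝ} (hS : (Matrix.of S).PosSemidef) (p : ℝ) :
    Integrable (fun x : EuclideanSpace ℝ ι => Real.exp (p * maxCoord x.ofLp)) (gaussLaw S) := by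
  refine Integrable.mono' (integrable_finsetSum Finset.univ
    fun i _ => gaussLaw_integrable_exp hS i p) ?_ (ae_of_all _ fun x => ?_)
  · have := continuous_maxCoord (ι := ι)
    exact Continuous.aestronglyMeasurable (by fun_prop)
  · rw [Real.norm_of_nonneg (Real.exp_pos _).le]
    exact exp_mul_maxCoord_le _ _

theorem integral_exp_mul_maxCoord_le {S : ι → ι → ℝ} (hS : (Matrix.of S).PosSemidef) (p : ℝ) :
    ∫ x : EuclideanSpace ℝ ι, Real.exp (p * maxCoord x.ofLp) ∂(gaussLaw S)
      ≤ ∑ i, Real.exp ((p ^ 2 - p) * S i i / 2) := by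
  simp_rw [← gaussLaw_integral_exp hS]
  rw [← integral_finsetSum _ fun i _ => gaussLaw_integrable_exp hS i p]
  exact integral_mono (integrable_exp_mul_maxCoord hS p)
    (integrable_finsetSum Finset.univ fun i _ => gaussLaw_integrable_exp hS i p)
    fun x => exp_mul_maxCoord_le _ _

/-- `min (exp (max_i x_i)) M` as a bounded continuous function. -/
noncomputable def truncExpMax (ι : Type*) [Fintype ι] [Nonempty ι] (M : ℝ) :
    BoundedContinuousFunction (EuclideanSpace ℝ ι) ℝ :=
  BoundedContinuousFunction.ofNormedAddCommGroup
    (fun x => min (Real.exp (maxCoord x.ofLp)) |M|)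
    (by have := continuous_maxCoord (ι := ι); fun_prop) |M| (fun x => by
      rw [Real.norm_of_nonneg (le_min (Real.exp_pos _).le (abs_nonneg _))]
      exact min_le_right _ _)

/-- For z = exp(max) one has z - min(z, M) ≤ z²/M, and the second moment of z is at most the sum of
E exp(2 x_i) = exp(S i i). -/
theorem abs_expMax_sub_trunc_le {S : ι → ι → ℝ} (hS : (Matrix.of S).PosSemidef) {M : ℝ}
    (hM : 0 < M) :
    |expMax S - ∫ x, truncExpMax ι M x ∂(gaussLaw S)| ≤ (∑ i, Real.exp (S i i)) / M := by
  have h1 : Integrable (fun x : EuclideanSpace ℝ ι => Real.exp (maxCoord x.ofLp)) (gaussLaw S) := by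
    simpa using integrable_exp_mul_maxCoord hS 1
  have h2 := integrable_exp_mul_maxCoord hS 2
  have h3 : Integrable (truncExpMax ι M) (gaussLaw S) :=
    BoundedContinuousFunction.integrable _ _
  rw [expMax, ← integral_sub h1 h3]
  refine (abs_integral_le_integral_abs).trans ?_
  have h4 : ∫ x : EuclideanSpace ℝ ι, |Real.exp (maxCoord x.ofLp) - truncExpMax ι M x| ∂(gaussLaw S)
      ≤ ∫ x : EuclideanSpace ℝ ι, Real.exp (2 * maxCoord x.ofLp) / M ∂(gaussLaw S) := by
    refine integral_mono (h1.sub h3).abs (h2.div_const _) fun x => ?_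
    simp only [truncExpMax, BoundedContinuousFunction.coe_ofNormedAddCommGroup, abs_of_pos hM]
    have e : Real.exp (2 * maxCoord x.ofLp) = Real.exp (maxCoord x.ofLp) ^ 2 := by
      rw [← Real.exp_nat_mul]; norm_num
    have hp := Real.exp_pos (maxCoord x.ofLp)
    rw [e, le_div_iff₀ hM]
    rcases le_total (Real.exp (maxCoord x.ofLp)) M with h | h
    · rw [min_eq_left h]; simp; positivity
    · rw [min_eq_right h, abs_of_nonneg (by linarith)]
      nlinarith
  refine h4.trans ?_
  rw [integral_div]
  gcongr
  exact (integral_exp_mul_maxCoord_le hS 2).trans_eq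
    (Finset.sum_congr rfl fun i _ => by congr 1; ring)

/-- Weak continuity does not apply directly, as exp(max) is unbounded. The truncation error is
uniform over bounded S, so `expMax` is a uniform limit of continuous functions. -/
theorem continuousOn_expMax (B : ℝ) : ContinuousOn (expMax : (ι → ι → ℝ) → ℝ)
    {S | (Matrix.of S).PosSemidef ∧ ∀ i j, S i j ∈ Icc (-B) B} := by
  refine continuousOn_of_uniform_approx_of_continuousOn fun u hu => ?_
  obtain ⟨ε, hε, hu⟩ := Metric.mem_uniformity_dist.1 hu
  let M := (Fintype.card ι * Real.exp B) / (ε / 2)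
  have hM : 0 < M := by positivity
  refine ⟨fun S => ∫ x, truncExpMax ι M x ∂(gaussLaw S),
    (continuousOn_integral_gaussLaw _).mono fun S hS => hS.1, fun S hS => hu ?_⟩
  rw [Real.dist_eq]
  refine (abs_expMax_sub_trunc_le hS.1 hM).trans_lt ?_
  have : ∑ i, Real.exp (S i i) ≤ Fintype.card ι * Real.exp B := by
    refine (Finset.sum_le_sum fun i _ => Real.exp_le_exp.2 (hS.2 i i).2).trans ?_
    simp
  have h3 : (∑ i, Real.exp (S i i)) / M ≤ ε / 2 := by
    rw [div_le_iff₀ hM]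
    refine this.trans (le_of_eq ?_)
    simp only [M]; field_simp
  linarith

theorem uniformContinuousOn_expMax (B : ℝ) : UniformContinuousOn (expMax : (ι → ι → ℝ) → ℝ)
    {S | (Matrix.of S).PosSemidef ∧ ∀ i j, S i j ∈ Icc (-B) B} :=
  (isCompact_posSemidef_box B).uniformContinuousOn_of_continuous (continuousOn_expMax B)

/-- Markov's inequality for exp(2 max). The exponent 2 is what beats the weight e^y in the integrals
to come. -/
theorem gaussLaw_tail_le {S : ι → ι → ℝ} (hS : (Matrix.of S).PosSemidef) (y : ℝ) :
    (gaussLaw S).real {x | ∃ k, y < x k} ≤ (∑ i, Real.exp (S i i)) * Real.exp (-(2 * y)) := by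
  have h2 := integrable_exp_mul_maxCoord hS 2
  have := mul_meas_ge_le_integral_of_nonneg (ae_of_all _ fun x => (Real.exp_pos _).le) h2
    (Real.exp (2 * y))
  have h3 := integral_exp_mul_maxCoord_le hS 2
  have h4 : (gaussLaw S).real {x | ∃ k, y < x k} ≤ (gaussLaw S).real
      {x | Real.exp (2 * y) ≤ Real.exp (2 * maxCoord x.ofLp)} := by
    refine measureReal_mono fun x hx => ?_
    have := lt_maxCoord.2 hx
    simp only [mem_ofPred_eq, Real.exp_le_exp]; linarith
  norm_num at h3
  rw [Real.exp_neg, ← div_eq_mul_inv, le_div_iff₀ (Real.exp_pos _)]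
  simp only [Measure.real] at *
  have h5 := mul_le_mul_of_nonneg_left h4 (Real.exp_pos (2 * y)).le
  linarith

omit [Nonempty ι] in
/-- Identification of the law of a Gaussian vector with mean `-S i i / 2` and covariance `S`. -/
theorem map_eq_gaussLaw {Ω' : Type*} [MeasurableSpace Ω'] {Q : Measure Ω'} {V : ι → Ω' → ℝ}
    (hV : HasGaussianLaw (fun ω i => V i ω) Q) {S : ι → ι → ℝ}
    (hmean : ∀ i, ∫ ω, V i ω ∂Q = -S i i / 2) (hcov : ∀ i j, covariance (V i) (V j) Q = S i j) :
    (Matrix.of S).PosSemidef ∧ Q.map (fun ω => WithLp.toLp 2 fun i => V i ω) = gaussLaw S := by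
  have hL2 : ∀ i, MemLp (V i) 2 Q := fun i => (hV.eval i).memLp_two
  have : IsProbabilityMeasure Q := hV.isProbabilityMeasure
  have hVar : ∀ x : ι → ℝ, Var[fun ω => ∑ i, x i * V i ω; Q] = ∑ i, x i * ∑ j, S i j * x j := by
    intro x
    rw [← covariance_self]
    · rw [covariance_fun_sum_fun_sum (fun i => (hL2 i).const_mul _) fun i => (hL2 i).const_mul _]
      simp only [Finset.mul_sum]
      refine Finset.sum_congr rfl fun i _ => Finset.sum_congr rfl fun j _ => ?_
      rw [covariance_const_mul_left, covariance_const_mul_right, hcov]; ring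
    · exact Finset.aemeasurable_fun_sum _ fun i _ => (hL2 i).1.aemeasurable.const_mul _
  have hS : (Matrix.of S).PosSemidef := by
    refine Matrix.PosSemidef.of_dotProduct_mulVec_nonneg ?_ fun x => ?_
    · ext i j
      simp [← hcov, covariance_comm (V j)]
    · have := variance_nonneg (fun ω => ∑ i, x i * V i ω) Q
      rw [hVar] at this
      simpa [dotProduct, Matrix.mulVec] using this
  refine ⟨hS, ?_⟩
  have hG := hV.toLp_pi 2
  have := Measure.isProbabilityMeasure_map hG.aemeasurable
  refine Measure.ext_of_charFun (funext fun x => ?_)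
  rw [hG.charFun_map_eq, gaussLaw, charFun_multivariateGaussian hS]
  have e : (fun ω => inner ℝ x (WithLp.toLp 2 fun i => V i ω)) = fun ω => ∑ i, x i * V i ω := by
    ext ω; simp [PiLp.inner_apply, mul_comm]
  rw [e, hVar, integral_finsetSum _ fun i _ => ((hL2 i).const_mul _).integrable (by norm_num)]
  simp only [integral_const_mul, hmean]
  congr 3
  simp [PiLp.inner_apply, mul_comm]

/-- The layer cake formula for `E exp(max_i V_i) - 1` when `max_i V_i ≥ 0`. -/
theorem lintegral_exp_mul_tail {Ω' : Type*} [MeasurableSpace Ω'] {Q : Measure Ω'} {V : ι → Ω' → ℝ}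
    {S : ι → ι → ℝ} (hVm : ∀ i, AEMeasurable (V i) Q) (hS : (Matrix.of S).PosSemidef)
    (hmap : Q.map (fun ω => WithLp.toLp 2 fun i => V i ω) = gaussLaw S)
    [IsProbabilityMeasure Q] (k₀ : ι) (hk₀ : ∀ᵐ ω ∂Q, V k₀ ω = 0) :
    1 ≤ expMax S ∧
    ∫⁻ y in Ioi (0 : ℝ), ENNReal.ofReal (Real.exp y) * Q {ω | ∃ k, y < V k ω}
      = ENNReal.ofReal (expMax S - 1) := by
  have hm : AEMeasurable (fun ω => WithLp.toLp 2 fun i => V i ω : Ω' → EuclideanSpace ℝ ι) Q :=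
    (WithLp.measurable_toLp 2 (ι → ℝ)).comp_aemeasurable (aemeasurable_pi_lambda _ hVm)
  have hmm : AEMeasurable (fun ω => maxCoord fun i => V i ω) Q :=
    continuous_maxCoord.measurable.comp_aemeasurable (aemeasurable_pi_lambda _ hVm)
  have hnn : 0 ≤ᵐ[Q] fun ω => maxCoord fun i => V i ω := by
    filter_upwards [hk₀] with ω h
    rw [Pi.zero_apply, ← h]
    exact Finset.le_sup' (fun i => V i ω) (Finset.mem_univ k₀)
  have hint : Integrable (fun ω => Real.exp (maxCoord fun i => V i ω)) Q := by
    have h1 := integrable_exp_mul_maxCoord hS 1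
    simp only [one_mul, ← hmap] at h1
    exact (integrable_map_measure h1.1 hm).1 h1
  have hE : expMax S = ∫ ω, Real.exp (maxCoord fun i => V i ω) ∂Q := by
    rw [expMax, ← hmap, integral_map hm]
    have := continuous_maxCoord (ι := ι)
    exact Continuous.aestronglyMeasurable (by fun_prop)
  have hsub : expMax S - 1 = ∫ ω, (Real.exp (maxCoord fun i => V i ω) - 1) ∂Q := by
    rw [integral_sub hint (integrable_const _), hE]; simp
  have hnn' : 0 ≤ᵐ[Q] fun ω => (Real.exp (maxCoord fun i => V i ω) - 1) := by
    filter_upwards [hnn] with ω h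
    simpa using h
  constructor
  · have := integral_nonneg_of_ae hnn'
    linarith
  have hint' : Integrable (fun ω => Real.exp (maxCoord fun i => V i ω) - 1) Q :=
    hint.sub (integrable_const _)
  rw [hsub, ofReal_integral_eq_lintegral_ofReal hint' hnn']
  -- Layer cake with density e^t: the integral of e^t over [0, max] is exp(max) - 1.
  have := lintegral_comp_eq_lintegral_meas_lt_mul (g := Real.exp) Q hnn hmm
    (fun t _ => Real.continuous_exp.intervalIntegrable _ _) (ae_of_all _ fun t => (Real.exp_pos t).le)
  simp only [integral_exp, Real.exp_zero, lt_maxCoord] at this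
  rw [this]
  simp_rw [mul_comm]

end GaussianMax

/-! ### Riemann sums for ∫ e^y T(y) dy with T antitone. -/

section AntitoneSums

variable {T : ℝ → ℝ}

theorem Antitone.intervalIntegrable_exp_mul (hT : Antitone T) (a b : ℝ) :
    IntervalIntegrable (fun y => Real.exp y * T y) volume a b :=
  hT.intervalIntegrable.continuousOn_mul Real.continuous_exp.continuousOn

theorem Antitone.intervalIntegrable_exp_mul_shift (hT : Antitone T) (s a b : ℝ) :
    IntervalIntegrable (fun y => Real.exp y * T (y + s)) volume a b :=
  (Antitone.intervalIntegrable fun _ _ h => hT (by linarith)).continuousOn_mul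
    Real.continuous_exp.continuousOn

theorem intervalIntegral_exp_mul_shift (s a b : ℝ) :
    ∫ y in a..b, Real.exp y * T (y + s)
      = Real.exp (-s) * ∫ y in (a + s)..(b + s), Real.exp y * T y := by
  rw [← intervalIntegral.integral_comp_add_right (fun y => Real.exp y * T y),
    ← intervalIntegral.integral_const_mul]
  refine intervalIntegral.integral_congr fun y _ => ?_
  simp only [← mul_assoc, ← Real.exp_add]
  congr 2; ring

/-- On [jη, (j+1)η] antitonicity gives T((j-1)η) ≤ T(y - 2η). Undoing the shift costs the factor
e^{2η}, and the stretch [-2η, 0] that it adds contributes at most 2η, since e^y T ≤ 1 there. -/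
theorem sum_exp_sub_mul_le_of_antitone (hT : Antitone T) (h0 : ∀ y, 0 ≤ T y) (h1 : ∀ y, T y ≤ 1)
    (hint : IntegrableOn (fun y => Real.exp y * T y) (Ioi 0)) {η : ℝ} (hη : 0 < η) (N : ℕ) :
    ∑ j ∈ Finset.range N, (Real.exp ((j + 1 : ℕ) * η) - Real.exp (j * η)) * T ((j - 1) * η)
      ≤ Real.exp (2 * η) * (2 * η + ∫ y in Ioi (0 : ℝ), Real.exp y * T y) := by
  have hstep : ∀ j : ℕ, (Real.exp ((j + 1 : ℕ) * η) - Real.exp (j * η)) * T ((j - 1) * η)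
      ≤ ∫ y in (j * η)..((j + 1 : ℕ) * η), Real.exp y * T (y + -(2 * η)) := by
    intro j
    have hle : (j : ℝ) * η ≤ (j + 1 : ℕ) * η := by push_cast; nlinarith
    rw [← integral_exp, ← intervalIntegral.integral_mul_const]
    refine intervalIntegral.integral_mono_on hle
      ((Real.continuous_exp.mul continuous_const).intervalIntegrable _ _)
      (hT.intervalIntegrable_exp_mul_shift _ _ _) fun y hy => ?_
    refine mul_le_mul_of_nonneg_left (hT ?_) (Real.exp_pos _).le
    have := hy.2; push_cast at this; linarith
  refine (Finset.sum_le_sum fun j _ => hstep j).trans ?_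
  rw [intervalIntegral.sum_integral_adjacent_intervals (a := fun j : ℕ => (j : ℝ) * η)
    fun j _ => hT.intervalIntegrable_exp_mul_shift _ _ _, intervalIntegral_exp_mul_shift, neg_neg]
  refine mul_le_mul_of_nonneg_left ?_ (Real.exp_pos _).le
  have hN : 0 ≤ (N : ℝ) * η := by positivity
  have i := hT.intervalIntegrable_exp_mul
  have e : ∫ y in (((0 : ℕ) : ℝ) * η + -(2 * η))..((N : ℝ) * η + -(2 * η)), Real.exp y * T y
      = (∫ y in (-(2 * η))..0, Real.exp y * T y) + (∫ y in 0..((N : ℝ) * η), Real.exp y * T y)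
        - ∫ y in ((N : ℝ) * η + -(2 * η))..((N : ℝ) * η), Real.exp y * T y := by
    rw [intervalIntegral.integral_add_adjacent_intervals (i _ _) (i _ _), eq_sub_iff_add_eq,
      intervalIntegral.integral_add_adjacent_intervals (i _ _) (i _ _)]
    simp
  rw [e]
  have n0 : ∀ y, 0 ≤ Real.exp y * T y := fun y => mul_nonneg (Real.exp_pos _).le (h0 y)
  have a1 : ∫ y in (-(2 * η))..0, Real.exp y * T y ≤ 2 * η := by
    have : ∫ y in (-(2 * η))..0, Real.exp y * T y ≤ ∫ y in (-(2 * η))..0, (1 : ℝ) := by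
      refine intervalIntegral.integral_mono_on (by linarith) (i _ _) (by simp) fun y hy => ?_
      exact mul_le_one₀ (Real.exp_le_one_iff.2 hy.2) (h0 y) (h1 y)
    simpa using this
  have a2 : ∫ y in 0..((N : ℝ) * η), Real.exp y * T y ≤ ∫ y in Ioi (0 : ℝ), Real.exp y * T y := by
    rw [intervalIntegral.integral_of_le hN]
    exact setIntegral_mono_set hint (ae_of_all _ n0) Ioc_subset_Ioi_self.eventuallyLE
  have a3 : 0 ≤ ∫ y in ((N : ℝ) * η + -(2 * η))..((N : ℝ) * η), Real.exp y * T y :=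
    intervalIntegral.integral_nonneg (by linarith) fun y _ => n0 y
  linarith

/-- On [(j+1)η, (j+2)η] antitonicity gives T((j+3)η) ≥ T(y + 2η). Undoing the shift leaves the
integral over [3η, (N+3)η]; the missing initial stretch is at most e^{3η} - 1, and the missing tail
is controlled by C. -/
theorem le_sum_exp_sub_mul_of_antitone (hT : Antitone T) (h0 : ∀ y, 0 ≤ T y) (h1 : ∀ y, T y ≤ 1)
    (hint : IntegrableOn (fun y => Real.exp y * T y) (Ioi 0)) {C : ℝ}
    (hC : ∀ y, T y ≤ C * Real.exp (-(2 * y))) {η : ℝ} (hη : 0 < η) (N : ℕ) :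
    Real.exp (-(2 * η)) * ((∫ y in Ioi (0 : ℝ), Real.exp y * T y) - (Real.exp (3 * η) - 1)
        - C * Real.exp (-((N + 3) * η)))
      ≤ ∑ j ∈ Finset.range N,
        (Real.exp (((j + 1 : ℕ) + 1) * η) - Real.exp ((j + 1) * η)) * T ((j + 3) * η) := by
  have hstep : ∀ j : ℕ, ∫ y in ((j + 1) * η)..(((j + 1 : ℕ) + 1) * η), Real.exp y * T (y + 2 * η) ≤
      (Real.exp (((j + 1 : ℕ) + 1) * η) - Real.exp ((j + 1) * η)) * T ((j + 3) * η) := by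
    intro j
    have hle : ((j : ℝ) + 1) * η ≤ ((j + 1 : ℕ) + 1) * η := by push_cast; nlinarith
    rw [← integral_exp, ← intervalIntegral.integral_mul_const]
    refine intervalIntegral.integral_mono_on hle (hT.intervalIntegrable_exp_mul_shift _ _ _)
      ((Real.continuous_exp.mul continuous_const).intervalIntegrable _ _) fun y hy => ?_
    refine mul_le_mul_of_nonneg_left (hT ?_) (Real.exp_pos _).le
    have := hy.1; linarith
  refine le_trans ?_ (Finset.sum_le_sum fun j _ => hstep j)
  rw [intervalIntegral.sum_integral_adjacent_intervals (a := fun j : ℕ => ((j : ℝ) + 1) * η)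
    fun j _ => hT.intervalIntegrable_exp_mul_shift _ _ _, intervalIntegral_exp_mul_shift]
  refine mul_le_mul_of_nonneg_left ?_ (Real.exp_pos _).le
  have i := hT.intervalIntegrable_exp_mul
  have hN : 0 ≤ ((N : ℝ) + 3) * η := by positivity
  have n0 : ∀ y, 0 ≤ Real.exp y * T y := fun y => mul_nonneg (Real.exp_pos _).le (h0 y)
  have e : ∫ y in ((((0 : ℕ) : ℝ) + 1) * η + 2 * η)..(((N : ℝ) + 1) * η + 2 * η), Real.exp y * T y
      = (∫ y in 0..(((N : ℝ) + 3) * η), Real.exp y * T y)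
        - ∫ y in 0..(3 * η), Real.exp y * T y := by
    rw [eq_sub_iff_add_eq, add_comm, show (((0 : ℕ) : ℝ) + 1) * η + 2 * η = 3 * η by push_cast; ring,
      show ((N : ℝ) + 1) * η + 2 * η = (N + 3) * η by ring,
      intervalIntegral.integral_add_adjacent_intervals (i _ _) (i _ _)]
  have e2 : (∫ y in Ioi (0 : ℝ), Real.exp y * T y)
      = (∫ y in 0..(((N : ℝ) + 3) * η), Real.exp y * T y)
        + ∫ y in Ioi (((N : ℝ) + 3) * η), Real.exp y * T y := by
    rw [intervalIntegral.integral_of_le hN, ← setIntegral_union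
      (Ioc_disjoint_Ioi le_rfl) measurableSet_Ioi
      (hint.mono_set Ioc_subset_Ioi_self) (hint.mono_set (Ioi_subset_Ioi hN)),
      Ioc_union_Ioi_eq_Ioi hN]
  have a1 : ∫ y in 0..(3 * η), Real.exp y * T y ≤ Real.exp (3 * η) - 1 := by
    have : ∫ y in 0..(3 * η), Real.exp y * T y ≤ ∫ y in 0..(3 * η), Real.exp y :=
      intervalIntegral.integral_mono_on (by positivity) (i _ _)
        (Real.continuous_exp.intervalIntegrable _ _) fun y _ =>
          mul_le_of_le_one_right (Real.exp_pos _).le (h1 y)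
    simpa using this
  have a2 : ∫ y in Ioi (((N : ℝ) + 3) * η), Real.exp y * T y
      ≤ C * Real.exp (-((N + 3) * η)) := by
    rw [← integral_exp_neg_Ioi, ← integral_const_mul]
    refine setIntegral_mono_on (hint.mono_set (Ioi_subset_Ioi hN))
      ((integrableOn_exp_neg_Ioi _).const_mul C) measurableSet_Ioi fun y _ => ?_
    refine (mul_le_mul_of_nonneg_left (hC y) (Real.exp_pos y).le).trans_eq ?_
    rw [mul_left_comm, ← Real.exp_add]; congr 2; ring
  rw [e]; linarith

theorem Antitone.integrableOn_exp_mul (hT : Antitone T) (h0 : ∀ y, 0 ≤ T y) {C : ℝ}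
    (hC : ∀ y, T y ≤ C * Real.exp (-(2 * y))) :
    IntegrableOn (fun y => Real.exp y * T y) (Ioi 0) := by
  refine Integrable.mono' ((integrableOn_exp_neg_Ioi 0).const_mul C)
    (Real.measurable_exp.mul hT.measurable).aestronglyMeasurable (ae_of_all _ fun y => ?_)
  rw [Real.norm_of_nonneg (mul_nonneg (Real.exp_pos _).le (h0 y))]
  refine (mul_le_mul_of_nonneg_left (hC y) (Real.exp_pos y).le).trans_eq ?_
  rw [mul_left_comm, ← Real.exp_add]; congr 2; ring

end AntitoneSums

/-! ### Slicing according to the value of X_c(t). -/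

section Strata

theorem psi_pos {x : ℝ} (hx : x ≠ 0) : 0 < psi x := by
  unfold psi; positivity

/-- Since (c - y/c)² = c² - 2y + y²/c², this is the source of the weight e^y in H_K. -/
theorem tendsto_psi_ratio (y : ℝ) :
    Tendsto (fun c => psi (c - y / c) / psi c) atTop (𝓝 (Real.exp y)) := by
  have h1 : Tendsto (fun c : ℝ => (c ^ 2)⁻¹) atTop (𝓝 0) :=
    (tendsto_pow_atTop two_ne_zero).inv_tendsto_atTop
  have h2 : Tendsto (fun c : ℝ => |1 - y * (c ^ 2)⁻¹|⁻¹ * Real.exp (y - y ^ 2 / 2 * (c ^ 2)⁻¹)) atTop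
      (𝓝 (|1 - y * 0|⁻¹ * Real.exp (y - y ^ 2 / 2 * 0))) := by
    refine Tendsto.mul (Tendsto.inv₀ ((tendsto_const_nhds.sub (h1.const_mul y)).abs) (by simp)) ?_
    exact (Real.continuous_exp.tendsto _).comp (tendsto_const_nhds.sub (h1.const_mul _))
  simp only [mul_zero, sub_zero, abs_one, inv_one, one_mul] at h2
  refine h2.congr' ?_
  filter_upwards [eventually_gt_atTop 0] with c hc
  have hs : ∀ x : ℝ, √(2 * Real.pi * x ^ 2) = √(2 * Real.pi) * |x| := fun x => by
    rw [Real.sqrt_mul (by positivity), Real.sqrt_sq_eq_abs]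
  unfold psi
  rw [hs, hs, show c - y / c = c * (1 - y * (c ^ 2)⁻¹) by field_simp, abs_mul, mul_pow,
    abs_of_pos hc]
  rw [show Real.exp (-(c ^ 2 * (1 - y * (c ^ 2)⁻¹) ^ 2) / 2)
    = Real.exp (-c ^ 2 / 2) * Real.exp (y - y ^ 2 / 2 * (c ^ 2)⁻¹) by
      rw [← Real.exp_add]; congr 1; field_simp; ring]
  have hp : √(2 * Real.pi) ≠ 0 := by positivity
  rw [mul_inv, mul_inv, mul_inv]
  field_simp

variable {d : ℕ} {Ω : Type*} [MeasurableSpace Ω] {P : Measure Ω}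
  {U : Set (EuclideanSpace ℝ (Fin d))} {X : ℝ → EuclideanSpace ℝ (Fin d) → Ω → ℝ}

theorem CondA1.eventually_abs_sub_le (hA1 : CondA1 P U X) {y : ℝ} (hy : 0 ≤ y) {ε : ℝ}
    (hε : 0 < ε) : ∀ᶠ c in atTop, ∀ t ∈ U,
      |P.real {ω | c - y / c < X c t ω} - Real.exp y * psi c| ≤ ε * psi c := by
  have he := Real.exp_pos y
  -- With ε' ≤ 1, ψ(c - y/c) ≤ (e^y + 1)ψ(c), so the two errors add up to ε'(e^y + 2)ψ(c).
  set ε' := min 1 (ε / (Real.exp y + 2)) with hε'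
  have hpos : 0 < ε' := by positivity
  have h1 : ε' ≤ 1 := min_le_left _ _
  have h2 : ε' * (Real.exp y + 2) ≤ ε := by
    rw [← le_div_iff₀ (by positivity)]; exact min_le_right _ _
  filter_upwards [hA1 (y + 1) (by linarith) ε' hpos,
    Metric.tendsto_nhds.1 (tendsto_psi_ratio y) ε' hpos, eventually_gt_atTop 0] with c hc1 hc2 hc t ht
  have hp := psi_pos hc.ne'
  have a := hc1 t ht y ⟨hy, by linarith⟩
  have b : |psi (c - y / c) - Real.exp y * psi c| ≤ ε' * psi c := by
    rw [Real.dist_eq] at hc2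
    have : psi (c - y / c) - Real.exp y * psi c
      = (psi (c - y / c) / psi c - Real.exp y) * psi c := by field_simp
    rw [this, abs_mul, abs_of_pos hp]
    gcongr
  have b' := abs_le.1 b
  have : ε' * psi (c - y / c) ≤ ε' * ((Real.exp y + 1) * psi c) := by
    gcongr
    nlinarith
  calc _ ≤ _ := abs_sub_le _ (psi (c - y / c)) _
    _ ≤ ε' * (Real.exp y + 2) * psi c := by linarith
    _ ≤ _ := by gcongr

theorem eventually_abs_stratum_sub_le [IsProbabilityMeasure P]
    (hX : IsNormalizedField P U X) (hA1 : CondA1 P U X) {A B : ℝ}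
    (hA : 0 ≤ A) (hAB : A ≤ B) {ε : ℝ} (hε : 0 < ε) : ∀ᶠ c in atTop, ∀ t ∈ U,
      |P.real {ω | c - B / c < X c t ω ∧ X c t ω ≤ c - A / c}
        - (Real.exp B - Real.exp A) * psi c| ≤ ε * psi c := by
  filter_upwards [hA1.eventually_abs_sub_le hA (half_pos hε),
    hA1.eventually_abs_sub_le (hA.trans hAB) (half_pos hε), hX, eventually_gt_atTop 0]
    with c h1 h2 h3 hc t ht
  have hs : {ω | c - B / c < X c t ω ∧ X c t ω ≤ c - A / c}
      = {ω | c - B / c < X c t ω} \ {ω | c - A / c < X c t ω} := by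
    ext ω; simp
  have hm := (h3 t ht).1
  have hsub : {ω | c - A / c < X c t ω} ⊆ {ω | c - B / c < X c t ω} := fun ω h => by
    have : A / c ≤ B / c := by gcongr
    simp only [mem_ofPred_eq] at h ⊢; linarith
  rw [hs, measureReal_sdiff hsub (measurableSet_lt measurable_const hm)]
  have a := abs_le.1 (h1 t ht)
  have b := abs_le.1 (h2 t ht)
  rw [abs_le]; constructor <;> linarith

/-- Integrating the conditional expectation over an event determined by Y removes the conditioning;
an almost everywhere bound on the kernel is all that this needs. -/
theorem abs_setIntegral_sub_le_of_condDistrib [IsProbabilityMeasure P] {ι : Type*} [Fintype ι]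
    {Y : Ω → ℝ} {Z : Ω → ι → ℝ} (hY : Measurable Y) (hZ : Measurable Z)
    (f : BoundedContinuousFunction (ι → ℝ) ℝ) {w ε a b : ℝ}
    (h : ∀ᵐ x ∂(P.map Y), x ∈ Ioc a b → |(∫ z, f z ∂(condDistrib Z Y P x)) - w| ≤ ε) :
    |(∫ ω in Y ⁻¹' Ioc a b, f (Z ω) ∂P) - w * P.real (Y ⁻¹' Ioc a b)|
      ≤ ε * P.real (Y ⁻¹' Ioc a b) := by
  have hmS : MeasurableSet (Y ⁻¹' Ioc a b) := hY measurableSet_Ioc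
  have hint : Integrable (fun ω => f (Z ω)) P :=
    Integrable.of_bound (f.continuous.measurable.comp hZ).aestronglyMeasurable ‖f‖
      (ae_of_all _ fun ω => f.norm_coe_le_norm _)
  have e1 := condExp_ae_eq_integral_condDistrib (μ := P) hY hZ.aemeasurable
    f.continuous.stronglyMeasurable hint
  have e2 := setIntegral_condExp (μ := P) (m := MeasurableSpace.comap Y inferInstance)
    hY.comap_le hint ⟨Ioc a b, measurableSet_Ioc, rfl⟩
  have hint2 : Integrable (fun ω => ∫ z, f z ∂(condDistrib Z Y P (Y ω))) P :=
    (integrable_condExp).congr e1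
  rw [← e2, setIntegral_congr_ae hmS (e1.mono fun ω h _ => h)]
  have e3 : w * P.real (Y ⁻¹' Ioc a b) = ∫ ω in Y ⁻¹' Ioc a b, w ∂P := by
    rw [setIntegral_const, smul_eq_mul, mul_comm]
  rw [e3, ← integral_sub hint2.integrableOn (integrable_const _), ← Real.norm_eq_abs]
  refine norm_setIntegral_le_of_norm_le_const_ae (measure_lt_top _ _) ?_
  rw [ae_restrict_iff' hmS]
  exact (ae_of_ae_map hY.aemeasurable h)

/-- On the slice A ≤ c(c - X_c(t)) < B, the conditional law from (A2) is nearly constant in y, and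
the slice has mass about (e^B - e^A)ψ(c). The condition A > 0 reflects that (A2) covers only
positive y. -/
theorem eventually_abs_stratum_integral_sub_le [IsProbabilityMeasure P] {Ω' : Type*}
    [MeasurableSpace Ω'] {Q : Measure Ω'} [IsProbabilityMeasure Q] {α : ℝ} {L : ℝ → ℝ}
    {W : EuclideanSpace ℝ (Fin d) → EuclideanSpace ℝ (Fin d) → Ω' → ℝ}
    (hX : IsNormalizedField P U X) (hA1 : CondA1 P U X) (hA2 : CondA2 P Q U X α L W)
    {a : ℝ} (ha : 0 < a) {m : ℕ} (hm : 0 < m)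
    (f : BoundedContinuousFunction ((Fin d → Fin m) → ℝ) ℝ) {A B : ℝ}
    (hA : 0 < A) (hAB : A ≤ B) {ε : ℝ} (hε : 0 < ε) : ∀ᶠ c in atTop, ∀ t ∈ U,
      (∀ k : Fin d → Fin m, t + Delta α L c • gridPt a k ∈ U) →
      |(∫ ω in X c t ⁻¹' Ioc (c - B / c) (c - A / c),
          f (fun k => c * (X c (t + Delta α L c • gridPt a k) ω - X c t ω)) ∂P)
        - (Real.exp B - Real.exp A) * psi c * ∫ ω', f (fun k => W t (gridPt a k) ω') ∂Q|
          ≤ ε * psi c := by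
  set R := Real.exp B - Real.exp A
  have hR : 0 ≤ R := sub_nonneg.2 (Real.exp_le_exp.2 hAB)
  -- The slice has mass at most (R + 1)ψ(c) once ε' ≤ 1, and the limit integral is at most ‖f‖; the
  -- denominator combines both errors.
  set ε' := min 1 (ε / (R + 1 + ‖f‖)) with hε'
  have hden : 0 < R + 1 + ‖f‖ := by positivity
  have hpos : 0 < ε' := by positivity
  have h1 : ε' ≤ 1 := min_le_left _ _
  have h2 : ε' * (R + 1 + ‖f‖) ≤ ε := by
    rw [← le_div_iff₀ hden]; exact min_le_right _ _
  filter_upwards [hA2 a ha m hm B (hA.trans_le hAB) f ε' hpos,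
    eventually_abs_stratum_sub_le hX hA1 hA.le hAB hpos, hX, eventually_gt_atTop 0]
    with c c1 c2 c3 hc t ht hgrid
  have hp := psi_pos hc.ne'
  have hY := (c3 t ht).1
  have hZ : Measurable fun ω (k : Fin d → Fin m) =>
      c * (X c (t + Delta α L c • gridPt a k) ω - X c t ω) :=
    measurable_pi_lambda _ fun k => (((c3 _ (hgrid k)).1).sub hY).const_mul c
  set w := ∫ ω', f (fun k => W t (gridPt a k) ω') ∂Q
  have hw : |w| ≤ ‖f‖ := by
    have := norm_integral_le_of_norm_le_const (μ := Q) (C := ‖f‖)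
      (f := fun ω' => f (fun k => W t (gridPt a k) ω')) (ae_of_all _ fun ω => f.norm_coe_le_norm _)
    simpa using this
  have key := abs_setIntegral_sub_le_of_condDistrib (P := P) hY hZ f (w := w) (ε := ε')
    (a := c - B / c) (b := c - A / c) (by
      filter_upwards [c1 t ht hgrid] with x hx hxI
      have hAc : 0 < A / c := by positivity
      -- The solution y of x = c - y/c, which lies in (0, B] on the slice.
      refine hx (c * (c - x)) ⟨mul_pos hc (by linarith [hxI.2]), ?_⟩ (by field_simp; ring)
      have := hxI.1
      rw [mul_comm, ← le_div_iff₀ hc]; linarith)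
  have hSt := c2 t ht
  change |P.real (X c t ⁻¹' Ioc (c - B / c) (c - A / c)) - _| ≤ _ at hSt
  set p := P.real (X c t ⁻¹' Ioc (c - B / c) (c - A / c))
  have hple : p ≤ (R + 1) * psi c := by
    have := (abs_le.1 hSt).2
    nlinarith
  calc _ ≤ _ := abs_sub_le _ (w * p) _
    _ ≤ ε' * p + |w| * (ε' * psi c) := by
      refine add_le_add key ?_
      rw [show w * p - R * psi c * w = w * (p - R * psi c) by ring, abs_mul]
      gcongr
    _ ≤ ε' * ((R + 1) * psi c) + ‖f‖ * (ε' * psi c) := by gcongr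
    _ = ε' * (R + 1 + ‖f‖) * psi c := by ring
    _ ≤ _ := by gcongr

end Strata

/-! ### Continuous approximation of the event that a maximum exceeds a level. -/

section Ramp

variable {ι : Type*} [Fintype ι] [Nonempty ι]

/-- The continuous function of `max_i x_i` that is `0` below `s`, `1` above `s + η` and linear in
between. -/
noncomputable def rampMax (ι : Type*) [Fintype ι] [Nonempty ι] (s η : ℝ) :
    BoundedContinuousFunction (ι → ℝ) ℝ :=
  BoundedContinuousFunction.ofNormedAddCommGroup
    (fun x => max 0 (min 1 ((maxCoord x - s) / η)))
    (by have := continuous_maxCoord (ι := ι); fun_prop) 1 (fun x => by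
      rw [Real.norm_of_nonneg (le_max_left _ _)]
      exact max_le zero_le_one (min_le_left _ _))

/-- Weak convergence tests only continuous functions, so indicators are sandwiched by ramps, at the
price of moving the level by η. -/
theorem measureReal_le_integral_rampMax_le {Ω : Type*} [MeasurableSpace Ω] {ν : Measure Ω}
    [IsFiniteMeasure ν] {Z : Ω → ι → ℝ} (hZ : AEMeasurable Z ν) (s : ℝ) {η : ℝ} (hη : 0 < η) :
    ν.real {ω | ∃ k, s + η < Z ω k} ≤ ∫ ω, rampMax ι s η (Z ω) ∂ν ∧
      ∫ ω, rampMax ι s η (Z ω) ∂ν ≤ ν.real {ω | ∃ k, s < Z ω k} := by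
  have hmm : AEMeasurable (fun ω => maxCoord (Z ω)) ν :=
    continuous_maxCoord.measurable.comp_aemeasurable hZ
  have hnull : ∀ u : ℝ, NullMeasurableSet {ω | ∃ k, u < Z ω k} ν := fun u => by
    simp_rw [← lt_maxCoord]
    exact hmm.nullMeasurable measurableSet_Ioi
  have hreal : ∀ u : ℝ, ν.real {ω | ∃ k, u < Z ω k}
      = ∫ ω, {ω | ∃ k, u < Z ω k}.indicator (fun _ => (1 : ℝ)) ω ∂ν := fun u => by
    rw [integral_indicator₀ (hnull u)]; simp
  have hi : ∀ u : ℝ, Integrable ({ω | ∃ k, u < Z ω k}.indicator (fun _ => (1 : ℝ))) ν := fun u =>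
    (integrable_const (1 : ℝ)).indicator₀ (hnull u)
  have hr : Integrable (fun ω => rampMax ι s η (Z ω)) ν :=
    Integrable.of_bound ((rampMax ι s η).continuous.measurable.comp_aemeasurable
      hZ).aestronglyMeasurable ‖rampMax ι s η‖ (ae_of_all _ fun ω => (rampMax ι s η).norm_coe_le_norm _)
  rw [hreal, hreal]
  refine ⟨integral_mono (hi _) hr fun ω => ?_, integral_mono hr (hi _) fun ω => ?_⟩
  · simp only [rampMax, BoundedContinuousFunction.coe_ofNormedAddCommGroup]
    by_cases h : ∃ k, s + η < Z ω k
    · rw [indicator_of_mem (by exact h)]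
      rw [← lt_maxCoord] at h
      refine le_max_of_le_right (le_min le_rfl ?_)
      rw [le_div_iff₀ hη]; linarith
    · rw [indicator_of_notMem (by exact h)]
      exact le_max_left _ _
  · simp only [rampMax, BoundedContinuousFunction.coe_ofNormedAddCommGroup]
    by_cases h : ∃ k, s < Z ω k
    · rw [indicator_of_mem (by exact h)]
      exact max_le zero_le_one (min_le_left _ _)
    · rw [indicator_of_notMem (by exact h)]
      rw [← lt_maxCoord, not_lt] at h
      refine max_le le_rfl ((min_le_right _ _).trans (div_nonpos_of_nonpos_of_nonneg ?_ hη.le))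
      linarith

end Ramp

/-! ### Exceedance probabilities over a finite grid. -/

section Discrete

variable {d : ℕ} {Ω : Type*} [MeasurableSpace Ω] {P : Measure Ω} [IsProbabilityMeasure P]
  {Ω' : Type*} [MeasurableSpace Ω'] {Q : Measure Ω'} [IsProbabilityMeasure Q]
  {U : Set (EuclideanSpace ℝ (Fin d))} {X : ℝ → EuclideanSpace ℝ (Fin d) → Ω → ℝ}
  {W : EuclideanSpace ℝ (Fin d) → EuclideanSpace ℝ (Fin d) → Ω' → ℝ} {α : ℝ} {L : ℝ → ℝ}

/-- `Q(max_k W_t(a k) > y)`, the maximum being over the grid `0 ≤ k_i < m`. -/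
noncomputable def gridTail (Q : Measure Ω')
    (W : EuclideanSpace ℝ (Fin d) → EuclideanSpace ℝ (Fin d) → Ω' → ℝ) (a : ℝ) (m : ℕ)
    (t : EuclideanSpace ℝ (Fin d)) (y : ℝ) : ℝ :=
  Q.real {ω | ∃ k : Fin d → Fin m, y < W t (gridPt a k) ω}

/-- The analogue of `HK` with the supremum over the grid `0 ≤ k_i < m` of mesh `a`. -/
noncomputable def gridH (Q : Measure Ω')
    (W : EuclideanSpace ℝ (Fin d) → EuclideanSpace ℝ (Fin d) → Ω' → ℝ) (a : ℝ) (m : ℕ)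
    (t : EuclideanSpace ℝ (Fin d)) : ℝ :=
  ∫ y in Ioi (0 : ℝ), Real.exp y * gridTail Q W a m t y

theorem antitone_gridTail (a : ℝ) (m : ℕ) (t : EuclideanSpace ℝ (Fin d)) :
    Antitone (gridTail Q W a m t) := fun _ _ h =>
  measureReal_mono fun _ ⟨k, hk⟩ => ⟨k, h.trans_lt hk⟩

omit [IsProbabilityMeasure Q] in
theorem gridTail_nonneg (a : ℝ) (m : ℕ) (t : EuclideanSpace ℝ (Fin d)) (y : ℝ) :
    0 ≤ gridTail Q W a m t y := measureReal_nonneg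

theorem gridTail_le_one (a : ℝ) (m : ℕ) (t : EuclideanSpace ℝ (Fin d)) (y : ℝ) :
    gridTail Q W a m t y ≤ 1 := measureReal_le_one

omit [IsProbabilityMeasure Q] in
theorem gridH_nonneg (a : ℝ) (m : ℕ) (t : EuclideanSpace ℝ (Fin d)) : 0 ≤ gridH Q W a m t :=
  integral_nonneg fun y => mul_nonneg (Real.exp_pos y).le (gridTail_nonneg a m t y)

theorem gridH_le {a : ℝ} {m : ℕ} {t : EuclideanSpace ℝ (Fin d)} {C : ℝ}
    (hC : ∀ y, gridTail Q W a m t y ≤ C * Real.exp (-(2 * y))) : gridH Q W a m t ≤ C := by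
  have h : gridH Q W a m t ≤ ∫ y in Ioi (0 : ℝ), C * Real.exp (-y) := by
    refine setIntegral_mono_on ((antitone_gridTail a m t).integrableOn_exp_mul
      (gridTail_nonneg a m t) hC) ((integrableOn_exp_neg_Ioi _).const_mul C) measurableSet_Ioi
      fun y _ => ?_
    refine (mul_le_mul_of_nonneg_left (hC y) (Real.exp_pos y).le).trans_eq ?_
    rw [mul_left_comm, ← Real.exp_add]; congr 2; ring
  rwa [integral_const_mul, integral_exp_neg_Ioi_zero, mul_one] at h

theorem gridPt_mem_orthant {m : ℕ} {a : ℝ} (ha : 0 ≤ a) (k : Fin d → Fin m) :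
    gridPt a k ∈ orthant d := fun i => by
  simp only [gridPt]; positivity

/-- If X_c(t) = c - y/c with γ + jη ≤ y < γ + (j+1)η, then exceeding c - γ/c at a grid point forces
an increment above jη. The slices sum to a Riemann sum for e^γ gridH; the event X_c(t) > c - γ/c
contributes e^γ, and (A3) bounds what lies below the last slice. The level c - γ/c instead of c is
what the passage to the cube requires. -/
theorem eventually_prob_grid_le (hX : IsNormalizedField P U X) (hA1 : CondA1 P U X)
    (hA2 : CondA2 P Q U X α L W) (hA3 : CondA3 P U X α L) {a : ℝ} (ha : 0 < a) {m : ℕ} [NeZero m]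
    (hW : ∀ t ∈ U, ∀ k : Fin d → Fin m, AEMeasurable (W t (gridPt a k)) Q)
    {C : ℝ} (hC : ∀ t ∈ U, ∀ y, gridTail Q W a m t y ≤ C * Real.exp (-(2 * y)))
    {γ : ℝ} (hγ : 0 < γ) {ε : ℝ} (hε : 0 < ε) : ∀ᶠ c in atTop, ∀ t ∈ U,
      (∀ k : Fin d → Fin m, t + Delta α L c • gridPt a k ∈ U) →
      P.real {ω | ∃ k : Fin d → Fin m, c - γ / c < X c (t + Delta α L c • gridPt a k) ω}
        ≤ (Real.exp γ * (1 + gridH Q W a m t) + ε) * psi c := by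
  -- The Riemann sum error, uniform in t because gridH ≤ C.
  obtain ⟨η, hη, hηε⟩ : ∃ η > 0, Real.exp γ *
      (Real.exp (2 * η) * (2 * η) + (Real.exp (2 * η) - 1) * C) ≤ ε / 4 := by
    have h1 : Continuous fun η : ℝ => Real.exp γ *
      (Real.exp (2 * η) * (2 * η) + (Real.exp (2 * η) - 1) * C) := by fun_prop
    have h2 := (h1.tendsto 0).mono_left (nhdsWithin_le_nhds (s := Ioi 0))
    simp only [mul_zero, Real.exp_zero, sub_self, zero_mul, add_zero] at h2
    obtain ⟨η, h3, h4⟩ := ((h2.eventually_le_const (by positivity : (0 : ℝ) < ε / 4)).and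
      self_mem_nhdsWithin).exists
    exact ⟨η, h4, h3⟩
  choose h hpos hlim hbd using fun k : Fin d → Fin m => hA3 (gridPt a k)
    (gridPt_mem_orthant ha.le k) γ hγ
  obtain ⟨N, hN⟩ : ∃ N : ℕ, ∑ k, h k (γ + N * η) ≤ ε / 4 := by
    have h1 : Tendsto (fun N : ℕ => γ + N * η) atTop atTop :=
      tendsto_atTop_add_const_left _ _
        (tendsto_natCast_atTop_atTop.atTop_mul_const hη)
    have h2 : Tendsto (fun N : ℕ => ∑ k, h k (γ + N * η)) atTop (𝓝 (∑ _k : Fin d → Fin m, 0)) :=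
      tendsto_finsetSum _ fun k _ => (hlim k).comp h1
    rw [Finset.sum_const_zero] at h2
    exact (h2.eventually_le_const (by positivity)).exists
  -- One share for each of the N slices and one for the event above them.
  set ε₁ := ε / (4 * (N + 1)) with hε₁
  have hε₁pos : 0 < ε₁ := by positivity
  have hε₁N : N * ε₁ + ε₁ = ε / 4 := by rw [hε₁]; field_simp
  have hstrat := fun j : ℕ => eventually_abs_stratum_integral_sub_le (L := L) (α := α) hX hA1 hA2 ha
    (NeZero.pos m) (rampMax (Fin d → Fin m) ((j - 1) * η) η) (A := γ + j * η)
    (B := γ + (j + 1 : ℕ) * η) (by positivity) (by push_cast; nlinarith) hε₁pos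
  filter_upwards [(Finset.eventually_all (Finset.range N)).2 fun j _ => hstrat j,
    eventually_all.2 fun k => hbd k (γ + N * η) (by positivity),
    hA1.eventually_abs_sub_le hγ.le hε₁pos, hX, eventually_gt_atTop 0]
    with c h1 h2 h3 h4 hc t ht hgrid
  have hp := psi_pos hc.ne'
  have hY := (h4 t ht).1
  set Y := X c t
  set Z := fun ω (k : Fin d → Fin m) => c * (X c (t + Delta α L c • gridPt a k) ω - Y ω) with hZdef
  have hZ : Measurable Z :=
    measurable_pi_lambda _ fun k => (((h4 _ (hgrid k)).1).sub hY).const_mul c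
  set S := fun j : ℕ => Y ⁻¹' Ioc (c - (γ + (j + 1 : ℕ) * η) / c) (c - (γ + j * η) / c) with hS
  have hsub : {ω | ∃ k : Fin d → Fin m, c - γ / c < X c (t + Delta α L c • gridPt a k) ω} ⊆
      ({ω | c - γ / c < Y ω} ∪ ⋃ j ∈ Finset.range N, ({ω | ∃ k, j * η < Z ω k} ∩ S j)) ∪
      ⋃ k ∈ (Finset.univ : Finset (Fin d → Fin m)),
        {ω | c - γ / c < X c (t + Delta α L c • gridPt a k) ω ∧ Y ω ≤ c - (γ + N * η) / c} := by
    rintro ω ⟨k, hk⟩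
    by_cases hlt : c - γ / c < Y ω
    · exact Or.inl (Or.inl hlt)
    by_cases hlt2 : Y ω ≤ c - (γ + N * η) / c
    · exact Or.inr (mem_biUnion (Finset.mem_coe.2 (Finset.mem_univ k)) ⟨hk, hlt2⟩)
    refine Or.inl (Or.inr ?_)
    rw [not_lt] at hlt
    rw [not_le] at hlt2
    have b1 : 0 ≤ (c * (c - Y ω) - γ) / η := by
      have : γ / c ≤ c - Y ω := by linarith
      rw [div_le_iff₀ hc] at this
      exact div_nonneg (by linarith) hη.le
    have b2 : c * (c - Y ω) - γ < N * η := by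
      have : c - Y ω < (γ + N * η) / c := by linarith
      rw [lt_div_iff₀ hc] at this
      linarith
    -- The index of the slice that contains X_c(t).
    set j := ⌊(c * (c - Y ω) - γ) / η⌋₊
    have j1 : j * η ≤ c * (c - Y ω) - γ := by
      rw [← le_div_iff₀ hη]; exact Nat.floor_le b1
    have j2 : c * (c - Y ω) - γ < (j + 1 : ℕ) * η := by
      rw [← div_lt_iff₀ hη]; push_cast; exact Nat.lt_floor_add_one _
    have j3 : j < N := by
      have : (j : ℝ) * η < N * η := j1.trans_lt b2
      exact_mod_cast lt_of_mul_lt_mul_right this hη.le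
    refine mem_biUnion (Finset.mem_coe.2 (Finset.mem_range.2 j3)) ⟨⟨k, ?_⟩, ?_, ?_⟩
    · refine j1.trans_lt ?_
      simp only [hZdef]
      have : c * (c - γ / c) < c * X c (t + Delta α L c • gridPt a k) ω := by gcongr
      rw [mul_sub, mul_div_cancel₀ _ hc.ne'] at this
      linarith
    · rw [sub_lt_comm, lt_div_iff₀ hc]; linarith
    · rw [le_sub_comm, div_le_iff₀ hc]; linarith
  have hstratum : ∀ j ∈ Finset.range N, P.real ({ω | ∃ k, j * η < Z ω k} ∩ S j) ≤
      (Real.exp γ * ((Real.exp ((j + 1 : ℕ) * η) - Real.exp (j * η))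
        * gridTail Q W a m t ((j - 1) * η)) + ε₁) * psi c := by
    intro j hj
    have e1 := (measureReal_le_integral_rampMax_le (ν := P.restrict (S j)) hZ.aemeasurable
      ((j - 1) * η) hη).1
    rw [measureReal_restrict_apply' (hY measurableSet_Ioc),
      show ((j : ℝ) - 1) * η + η = j * η by ring] at e1
    have e2 := (abs_le.1 (h1 j hj t ht hgrid)).2
    have e3 := (measureReal_le_integral_rampMax_le (ν := Q)
      (aemeasurable_pi_lambda (fun ω (k : Fin d → Fin m) => W t (gridPt a k) ω) (hW t ht))
      ((j - 1) * η) hη).2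
    rw [Real.exp_add, Real.exp_add, ← mul_sub] at e2
    have hnn : 0 ≤ Real.exp γ * (Real.exp ((j + 1 : ℕ) * η) - Real.exp (j * η)) * psi c := by
      have : Real.exp (j * η) ≤ Real.exp ((j + 1 : ℕ) * η) :=
        Real.exp_le_exp.2 (by push_cast; nlinarith)
      have := sub_nonneg.2 this
      positivity
    have e4 := mul_le_mul_of_nonneg_left e3 hnn
    change _ ≤ _ * gridTail Q W a m t _ at e4
    linarith
  have hJ := sum_exp_sub_mul_le_of_antitone (antitone_gridTail (Q := Q) (W := W) a m t)
    (gridTail_nonneg a m t) (gridTail_le_one a m t) ((antitone_gridTail a m t).integrableOn_exp_mul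
      (gridTail_nonneg a m t) (hC t ht)) hη N
  change _ ≤ Real.exp (2 * η) * (2 * η + gridH Q W a m t) at hJ
  have hJC := gridH_le (hC t ht)
  have hJ2 : Real.exp γ * (Real.exp (2 * η) * (2 * η + gridH Q W a m t))
      ≤ Real.exp γ * gridH Q W a m t + ε / 4 := by
    have : (Real.exp (2 * η) - 1) * gridH Q W a m t ≤ (Real.exp (2 * η) - 1) * C :=
      mul_le_mul_of_nonneg_left hJC (sub_nonneg.2 (Real.one_le_exp (by positivity)))
    have := mul_le_mul_of_nonneg_left this (Real.exp_pos γ).le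
    linarith
  have s1 : P.real {ω | c - γ / c < Y ω} ≤ (Real.exp γ + ε₁) * psi c := by
    have := (abs_le.1 (h3 t ht)).2
    linarith
  have s2 : P.real (⋃ j ∈ Finset.range N, ({ω | ∃ k, j * η < Z ω k} ∩ S j))
      ≤ (Real.exp γ * gridH Q W a m t + ε / 4 + N * ε₁) * psi c := by
    refine (measureReal_biUnion_finset_le _ _).trans ((Finset.sum_le_sum hstratum).trans ?_)
    rw [← Finset.sum_mul, Finset.sum_add_distrib, ← Finset.mul_sum, Finset.sum_const,
      Finset.card_range, nsmul_eq_mul]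
    gcongr
    exact (mul_le_mul_of_nonneg_left hJ (Real.exp_pos γ).le).trans hJ2
  have s3 : P.real (⋃ k ∈ (Finset.univ : Finset (Fin d → Fin m)),
      {ω | c - γ / c < X c (t + Delta α L c • gridPt a k) ω ∧ Y ω ≤ c - (γ + N * η) / c})
      ≤ ε / 4 * psi c := by
    refine (measureReal_biUnion_finset_le _ _).trans
      ((Finset.sum_le_sum fun k _ => h2 k t ht (hgrid k)).trans ?_)
    rw [← Finset.sum_mul]
    gcongr
  calc _ ≤ _ := measureReal_mono hsub
    _ ≤ _ := (measureReal_union_le _ _).trans (add_le_add (measureReal_union_le _ _) le_rfl)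
    _ ≤ (Real.exp γ + ε₁) * psi c + (Real.exp γ * gridH Q W a m t + ε / 4 + N * ε₁) * psi c
        + ε / 4 * psi c := by gcongr
    _ = (Real.exp γ * (1 + gridH Q W a m t) + (N * ε₁ + ε₁) + ε / 2) * psi c := by ring
    _ ≤ _ := by rw [hε₁N]; exact mul_le_mul_of_nonneg_right (by linarith) hp.le

/-- The slices are disjoint, and an increment above (j+2)η from slice j certainly reaches c. What
lies below the last slice is simply discarded, so (A3) plays no role here. -/
theorem eventually_le_prob_grid (hX : IsNormalizedField P U X) (hA1 : CondA1 P U X)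
    (hA2 : CondA2 P Q U X α L W) {a : ℝ} (ha : 0 < a) {m : ℕ} [NeZero m]
    (hW : ∀ t ∈ U, ∀ k : Fin d → Fin m, AEMeasurable (W t (gridPt a k)) Q)
    {C : ℝ} (hC : ∀ t ∈ U, ∀ y, gridTail Q W a m t y ≤ C * Real.exp (-(2 * y)))
    {ε : ℝ} (hε : 0 < ε) : ∀ᶠ c in atTop, ∀ t ∈ U,
      (∀ k : Fin d → Fin m, t + Delta α L c • gridPt a k ∈ U) →
      (1 + gridH Q W a m t - ε) * psi c
        ≤ P.real {ω | ∃ k : Fin d → Fin m, c < X c (t + Delta α L c • gridPt a k) ω} := by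
  obtain ⟨η, hη, hηε⟩ : ∃ η > 0, (1 - Real.exp (-(2 * η))) * C + (Real.exp (3 * η) - 1) ≤ ε / 4 := by
    have h1 : Continuous fun η : ℝ =>
      (1 - Real.exp (-(2 * η))) * C + (Real.exp (3 * η) - 1) := by fun_prop
    have h2 := (h1.tendsto 0).mono_left (nhdsWithin_le_nhds (s := Ioi 0))
    simp only [mul_zero, Real.exp_zero, sub_self, zero_mul, add_zero, neg_zero] at h2
    obtain ⟨η, h3, h4⟩ := ((h2.eventually_le_const (by positivity : (0 : ℝ) < ε / 4)).and
      self_mem_nhdsWithin).exists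
    exact ⟨η, h4, h3⟩
  obtain ⟨N, hN⟩ : ∃ N : ℕ, |C| * Real.exp (-((N + 3) * η)) ≤ ε / 4 := by
    have h1 : Tendsto (fun N : ℕ => ((N : ℝ) + 3) * η) atTop atTop :=
      (tendsto_atTop_add_const_right _ _ tendsto_natCast_atTop_atTop).atTop_mul_const hη
    have h2 := (Real.tendsto_exp_neg_atTop_nhds_zero.comp h1).const_mul |C|
    rw [mul_zero] at h2
    exact (h2.eventually_le_const (by positivity)).exists
  set ε₁ := ε / (4 * (N + 1)) with hε₁
  have hε₁pos : 0 < ε₁ := by positivity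
  have hε₁N : N * ε₁ + ε₁ = ε / 4 := by rw [hε₁]; field_simp
  -- The slices start at η and not at 0, because they need a positive lower end.
  have hstrat := fun j : ℕ => eventually_abs_stratum_integral_sub_le (L := L) (α := α) hX hA1 hA2 ha
    (NeZero.pos m) (rampMax (Fin d → Fin m) ((j + 2) * η) η) (A := (j + 1) * η)
    (B := ((j + 1 : ℕ) + 1) * η) (by positivity) (by push_cast; nlinarith) hε₁pos
  filter_upwards [(Finset.eventually_all (Finset.range N)).2 fun j _ => hstrat j,
    hA1.eventually_abs_sub_le le_rfl hε₁pos, hX, eventually_gt_atTop 0]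
    with c h1 h3 h4 hc t ht hgrid
  have hp := psi_pos hc.ne'
  have hY := (h4 t ht).1
  set Y := X c t with hYdef
  set Z := fun ω (k : Fin d → Fin m) => c * (X c (t + Delta α L c • gridPt a k) ω - Y ω) with hZdef
  have hZ : Measurable Z :=
    measurable_pi_lambda _ fun k => (((h4 _ (hgrid k)).1).sub hY).const_mul c
  set S := fun j : ℕ => Y ⁻¹' Ioc (c - (((j + 1 : ℕ) : ℝ) + 1) * η / c) (c - (j + 1) * η / c) with hS
  have hSiff : ∀ j ω, ω ∈ S j ↔ (j + 1) * η ≤ c * (c - Y ω) ∧ c * (c - Y ω) < (j + 2) * η := by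
    intro j ω
    simp only [hS, mem_preimage, mem_Ioc]
    rw [sub_lt_comm, le_sub_comm, lt_div_iff₀ hc, div_le_iff₀ hc]
    push_cast
    constructor <;> rintro ⟨h, h'⟩ <;> constructor <;> linarith
  have hsub : {ω | c < Y ω} ∪ ⋃ j ∈ Finset.range N, ({ω | ∃ k, (j + 2) * η < Z ω k} ∩ S j) ⊆
      {ω | ∃ k : Fin d → Fin m, c < X c (t + Delta α L c • gridPt a k) ω} := by
    rintro ω (h | h)
    -- The grid contains t itself, which accounts for the 1 in 1 + gridH.
    · refine ⟨fun _ => 0, ?_⟩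
      have : gridPt a (fun _ : Fin d => (0 : Fin m)) = 0 := by
        ext i; simp [gridPt]
      simpa [this] using h
    · obtain ⟨j, -, ⟨k, hk⟩, hj⟩ := mem_iUnion₂.1 h
      refine ⟨k, ?_⟩
      have := ((hSiff j ω).1 hj).2.trans hk
      simp only [hZdef] at this
      have := lt_of_mul_lt_mul_left this hc.le
      linarith
  have hmeas : ∀ j : ℕ, MeasurableSet ({ω | ∃ k, ((j : ℝ) + 2) * η < Z ω k} ∩ S j) := fun j => by
    refine MeasurableSet.inter ?_ (hY measurableSet_Ioc)
    simp_rw [ofPred_exists]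
    exact MeasurableSet.iUnion fun k =>
      measurableSet_lt measurable_const ((measurable_pi_apply k).comp hZ)
  have hdisj : ((Finset.range N : Finset ℕ) : Set ℕ).PairwiseDisjoint
      fun j : ℕ => {ω | ∃ k, ((j : ℝ) + 2) * η < Z ω k} ∩ S j := by
    intro i _ j _ hij
    refine Set.disjoint_left.2 fun ω hi hj => hij ?_
    have hi := (hSiff i ω).1 hi.2
    have hj := (hSiff j ω).1 hj.2
    have u1 : (i : ℝ) + 1 < j + 2 := lt_of_mul_lt_mul_right (hi.1.trans_lt hj.2) hη.le
    have u2 : (j : ℝ) + 1 < i + 2 := lt_of_mul_lt_mul_right (hj.1.trans_lt hi.2) hη.le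
    have u1 : i + 1 < j + 2 := by exact_mod_cast u1
    have u2 : j + 1 < i + 2 := by exact_mod_cast u2
    omega
  have hdisj2 : Disjoint {ω | c < Y ω}
      (⋃ j ∈ Finset.range N, ({ω | ∃ k, ((j : ℝ) + 2) * η < Z ω k} ∩ S j)) := by
    refine Set.disjoint_left.2 fun ω hi hj => ?_
    obtain ⟨j, -, -, hj⟩ := mem_iUnion₂.1 hj
    have u := ((hSiff j ω).1 hj).1
    have hi : c < Y ω := hi
    have : 0 < (j + 1) * η := by positivity
    nlinarith
  have hstratum : ∀ j ∈ Finset.range N, ((Real.exp (((j + 1 : ℕ) + 1) * η) - Real.exp ((j + 1) * η))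
        * gridTail Q W a m t ((j + 3) * η) - ε₁) * psi c
      ≤ P.real ({ω | ∃ k, (j + 2) * η < Z ω k} ∩ S j) := by
    intro j hj
    have e1 := (measureReal_le_integral_rampMax_le (ν := P.restrict (S j)) hZ.aemeasurable
      ((j + 2) * η) hη).2
    rw [measureReal_restrict_apply' (hY measurableSet_Ioc)] at e1
    have e2 := (abs_le.1 (h1 j hj t ht hgrid)).1
    have e3 := (measureReal_le_integral_rampMax_le (ν := Q)
      (aemeasurable_pi_lambda (fun ω (k : Fin d → Fin m) => W t (gridPt a k) ω) (hW t ht))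
      ((j + 2) * η) hη).1
    rw [show ((j : ℝ) + 2) * η + η = (j + 3) * η by ring] at e3
    have hnn : 0 ≤ (Real.exp (((j + 1 : ℕ) + 1) * η) - Real.exp ((j + 1) * η)) * psi c := by
      have : Real.exp ((j + 1) * η) ≤ Real.exp (((j + 1 : ℕ) + 1) * η) :=
        Real.exp_le_exp.2 (by push_cast; nlinarith)
      have := sub_nonneg.2 this
      positivity
    have e4 := mul_le_mul_of_nonneg_left e3 hnn
    change _ * gridTail Q W a m t _ ≤ _ at e4
    linarith
  have hJ := le_sum_exp_sub_mul_of_antitone (antitone_gridTail (Q := Q) (W := W) a m t)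
    (gridTail_nonneg a m t) (gridTail_le_one a m t) ((antitone_gridTail a m t).integrableOn_exp_mul
      (gridTail_nonneg a m t) (hC t ht)) (hC t ht) hη N
  change Real.exp (-(2 * η)) * (gridH Q W a m t - _ - _) ≤ _ at hJ
  have hJC := gridH_le (hC t ht)
  have hJ2 : gridH Q W a m t - ε / 2
      ≤ Real.exp (-(2 * η)) * (gridH Q W a m t - (Real.exp (3 * η) - 1)
        - C * Real.exp (-((N + 3) * η))) := by
    have q1 : Real.exp (-(2 * η)) ≤ 1 := Real.exp_le_one_iff.2 (by linarith)
    have q0 := Real.exp_pos (-(2 * η))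
    have r1 : (1 - Real.exp (-(2 * η))) * gridH Q W a m t ≤ (1 - Real.exp (-(2 * η))) * C :=
      mul_le_mul_of_nonneg_left hJC (sub_nonneg.2 q1)
    have r2 : C * Real.exp (-((N + 3) * η)) ≤ ε / 4 :=
      (mul_le_mul_of_nonneg_right (le_abs_self C) (Real.exp_pos _).le).trans hN
    have r3 : Real.exp (-(2 * η)) * (C * Real.exp (-((N + 3) * η))) ≤ ε / 4 := by
      nlinarith
    have r4 : Real.exp (-(2 * η)) * (Real.exp (3 * η) - 1) ≤ Real.exp (3 * η) - 1 :=
      mul_le_of_le_one_left (sub_nonneg.2 (Real.one_le_exp (by positivity))) q1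
    linarith
  have s1 : (1 - ε₁) * psi c ≤ P.real {ω | c < Y ω} := by
    have := (abs_le.1 (h3 t ht)).1
    simp only [zero_div, sub_zero, Real.exp_zero] at this
    linarith
  refine le_trans ?_ (measureReal_mono hsub)
  rw [measureReal_union hdisj2 (Finset.measurableSet_biUnion _ fun j _ => hmeas j)
    (measure_ne_top _ _) (measure_ne_top _ _),
    measureReal_biUnion_finset hdisj fun j _ => hmeas j]
  refine le_trans ?_ (add_le_add s1 (Finset.sum_le_sum hstratum))
  rw [← Finset.sum_mul, Finset.sum_sub_distrib, Finset.sum_const, Finset.card_range, nsmul_eq_mul,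
    ← add_mul]
  gcongr
  linarith

end Discrete

/-! ### The limit field on grids, and H_K as a supremum over dyadic grids. -/

section LimitField

variable {d : ℕ} {Ω' : Type*} [MeasurableSpace Ω'] {Q : Measure Ω'} [IsProbabilityMeasure Q]
  {U : Set (EuclideanSpace ℝ (Fin d))} {α : ℝ}
  {r : EuclideanSpace ℝ (Fin d) → EuclideanSpace ℝ (Fin d) → ℝ}
  {W : EuclideanSpace ℝ (Fin d) → EuclideanSpace ℝ (Fin d) → Ω' → ℝ}

theorem increVar_zero (hα : 0 < α) (t : EuclideanSpace ℝ (Fin d)) : increVar α r t 0 = 0 := by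
  simp [increVar, Real.zero_rpow hα.ne']

theorem inv_norm_smul_mem_sphere {u : EuclideanSpace ℝ (Fin d)} (hu : u ≠ 0) :
    ‖u‖⁻¹ • u ∈ Metric.sphere (0 : EuclideanSpace ℝ (Fin d)) 1 := by
  simp [norm_smul, hu]

theorem IsRFamily.exists_abs_increVar_le (hr : IsRFamily U r) (hα : 0 < α)
    (u : EuclideanSpace ℝ (Fin d)) : ∃ B, ∀ t ∈ U, |increVar α r t u| ≤ B := by
  obtain ⟨M, hM⟩ := hr.bdd
  rcases eq_or_ne u 0 with rfl | hu
  · exact ⟨0, fun t _ => by simp [increVar_zero hα]⟩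
  refine ⟨‖u‖ ^ α * M, fun t ht => ?_⟩
  have hs := inv_norm_smul_mem_sphere hu
  have hpos := hr.pos t ht _ hs
  rw [increVar, abs_mul, abs_of_pos hpos, abs_of_nonneg (by positivity)]
  gcongr
  exact hM t ht _ hs

theorem IsRFamily.uniformContinuousOn_increVar (hr : IsRFamily U r) (hα : 0 < α)
    (u : EuclideanSpace ℝ (Fin d)) : UniformContinuousOn (fun t => increVar α r t u) U := by
  rcases eq_or_ne u 0 with rfl | hu
  · simp only [increVar_zero hα]
    exact uniformContinuous_const.uniformContinuousOn
  have hp : 0 < ‖u‖ ^ α := Real.rpow_pos_of_pos (norm_pos_iff.2 hu) _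
  refine Metric.uniformContinuousOn_iff.2 fun ε hε => ?_
  obtain ⟨η, hη, h⟩ := hr.unif (ε / 2 / ‖u‖ ^ α) (by positivity)
  refine ⟨η, hη, fun t ht s hs hts => ?_⟩
  rw [dist_comm, dist_eq_norm] at hts
  have := h t ht s hs hts _ (inv_norm_smul_mem_sphere hu)
  rw [Real.dist_eq]
  simp only [increVar]
  rw [← mul_sub, abs_mul, abs_of_pos hp]
  rw [le_div_iff₀ hp] at this
  linarith

/-- The covariance matrix of `W_t` on the grid `0 ≤ k_i < m` of mesh `a`. -/
noncomputable def gridCov (α : ℝ) (r : EuclideanSpace ℝ (Fin d) → EuclideanSpace ℝ (Fin d) → ℝ)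
    (a : ℝ) (m : ℕ) (t : EuclideanSpace ℝ (Fin d)) (k l : Fin d → Fin m) : ℝ :=
  (increVar α r t (gridPt a k) + increVar α r t (gridPt a l)
    - increVar α r t (gridPt a k - gridPt a l)) / 2

theorem IsRFamily.uniformContinuousOn_gridCov (hr : IsRFamily U r) (hα : 0 < α) (a : ℝ) (m : ℕ) :
    UniformContinuousOn (gridCov α r a m) U := by
  rw [uniformContinuousOn_iff_restrict, uniformContinuous_pi]
  refine fun k => uniformContinuous_pi.2 fun l => ?_
  have h := fun u => uniformContinuousOn_iff_restrict.1 (hr.uniformContinuousOn_increVar hα u)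
  refine ((((h (gridPt a k)).add (h (gridPt a l))).sub
    (h (gridPt a k - gridPt a l))).const_smul (2⁻¹ : ℝ)).congr fun t => ?_
  simp [gridCov, div_eq_inv_mul]

theorem IsRFamily.exists_gridCov_mem_Icc (hr : IsRFamily U r) (hα : 0 < α) (a : ℝ) (m : ℕ) :
    ∃ B, ∀ t ∈ U, ∀ k l, gridCov α r a m t k l ∈ Icc (-B) B := by
  choose B hB using hr.exists_abs_increVar_le (α := α) hα
  have hB0 : ∀ t ∈ U, ∀ u, 0 ≤ B u := fun t ht u => (abs_nonneg _).trans (hB u t ht)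
  refine ⟨∑ k : Fin d → Fin m, ∑ l : Fin d → Fin m,
    (B (gridPt a k) + B (gridPt a l) + B (gridPt a k - gridPt a l)), fun t ht k l => abs_le.1 ?_⟩
  have hnn : ∀ k l : Fin d → Fin m,
      0 ≤ B (gridPt a k) + B (gridPt a l) + B (gridPt a k - gridPt a l) := fun k l =>
    add_nonneg (add_nonneg (hB0 t ht _) (hB0 t ht _)) (hB0 t ht _)
  refine le_trans ?_ ((Finset.single_le_sum (fun l _ => hnn k l) (Finset.mem_univ l)).trans
    (Finset.single_le_sum (f := fun k => ∑ l : Fin d → Fin m,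
      (B (gridPt a k) + B (gridPt a l) + B (gridPt a k - gridPt a l)))
      (fun k _ => Finset.sum_nonneg fun l _ => hnn k l) (Finset.mem_univ k)))
  have h1 := abs_le.1 (hB (gridPt a k) t ht)
  have h2 := abs_le.1 (hB (gridPt a l) t ht)
  have h3 := abs_le.1 (hB (gridPt a k - gridPt a l) t ht)
  rw [gridCov, abs_le]
  constructor <;> linarith [hnn k l]

omit [IsProbabilityMeasure Q] in
theorem IsLimitField.hasGaussianLaw_grid (hW : IsLimitField Q U α r W) {a : ℝ} (ha : 0 ≤ a)
    (m : ℕ) {t : EuclideanSpace ℝ (Fin d)} (ht : t ∈ U) :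
    HasGaussianLaw (fun ω (k : Fin d → Fin m) => W t (gridPt a k) ω) Q := by
  classical
  let p : (Fin d → Fin m) → orthant d := fun k => ⟨gridPt a k, gridPt_mem_orthant ha k⟩
  have h := (hW.gaussian t ht).hasGaussianLaw (Finset.univ.image p)
  exact h.map (ContinuousLinearMap.pi fun k => ContinuousLinearMap.proj
    (⟨p k, Finset.mem_image_of_mem p (Finset.mem_univ k)⟩ : (Finset.univ.image p : Finset _)))

omit [IsProbabilityMeasure Q] in
theorem IsLimitField.map_grid (hW : IsLimitField Q U α r W) (hα : 0 < α) {a : ℝ} (ha : 0 ≤ a)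
    (m : ℕ) {t : EuclideanSpace ℝ (Fin d)} (ht : t ∈ U) :
    (Matrix.of (gridCov α r a m t)).PosSemidef ∧
      Q.map (fun ω => WithLp.toLp 2 fun k => W t (gridPt a k) ω) = gaussLaw (gridCov α r a m t) := by
  refine map_eq_gaussLaw (V := fun k => W t (gridPt a k)) (hW.hasGaussianLaw_grid ha m ht) ?_ ?_
  · intro k
    rw [hW.mean t ht _ (gridPt_mem_orthant ha k), gridCov, sub_self, increVar_zero hα]
    ring
  · intro k l
    rw [hW.cov t ht _ (gridPt_mem_orthant ha k) _ (gridPt_mem_orthant ha l), gridCov]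

omit [IsProbabilityMeasure Q] in
theorem IsLimitField.aemeasurable_grid (hW : IsLimitField Q U α r W) {a : ℝ} (ha : 0 ≤ a)
    {m : ℕ} {t : EuclideanSpace ℝ (Fin d)} (ht : t ∈ U) (k : Fin d → Fin m) :
    AEMeasurable (W t (gridPt a k)) Q :=
  (hW.gaussian t ht).aemeasurable ⟨gridPt a k, gridPt_mem_orthant ha k⟩

omit [IsProbabilityMeasure Q] in
theorem IsLimitField.exists_gridTail_le (hW : IsLimitField Q U α r W) (hr : IsRFamily U r)
    (hα : 0 < α) {a : ℝ} (ha : 0 ≤ a) (m : ℕ) [NeZero m] :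
    ∃ C, ∀ t ∈ U, ∀ y, gridTail Q W a m t y ≤ C * Real.exp (-(2 * y)) := by
  obtain ⟨B, hB⟩ := hr.exists_gridCov_mem_Icc hα a m
  refine ⟨Fintype.card (Fin d → Fin m) * Real.exp B, fun t ht y => ?_⟩
  obtain ⟨hS, hmap⟩ := hW.map_grid hα ha m ht
  have h := gaussLaw_tail_le hS y
  have hm : AEMeasurable (fun ω => WithLp.toLp 2 fun k => W t (gridPt a k) ω :
      Ω' → EuclideanSpace ℝ (Fin d → Fin m)) Q :=
    (WithLp.measurable_toLp 2 _).comp_aemeasurable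
      (aemeasurable_pi_lambda _ fun k => hW.aemeasurable_grid ha ht k)
  have hms : MeasurableSet {x : EuclideanSpace ℝ (Fin d → Fin m) | ∃ k, y < x k} := by
    simp_rw [ofPred_exists]
    exact MeasurableSet.iUnion fun k => measurableSet_lt measurable_const (by fun_prop)
  rw [← hmap, map_measureReal_apply_of_aemeasurable hm hms] at h
  refine h.trans (mul_le_mul_of_nonneg_right ?_ (Real.exp_pos _).le)
  refine (Finset.sum_le_sum fun k _ => Real.exp_le_exp.2 (hB t ht k k).2).trans ?_
  simp

/-- The grid contains 0, where W_t vanishes, so the maximum is nonnegative and the layer cake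
formula applies. Thus t enters gridH only through the covariance matrix. -/
theorem IsLimitField.expMax_gridCov (hW : IsLimitField Q U α r W) (hα : 0 < α)
    {a : ℝ} (ha : 0 ≤ a) (m : ℕ) [NeZero m] {t : EuclideanSpace ℝ (Fin d)} (ht : t ∈ U) :
    gridH Q W a m t = expMax (gridCov α r a m t) - 1 ∧
    ∫⁻ y in Ioi (0 : ℝ), ENNReal.ofReal (Real.exp y)
        * Q {ω | ∃ k : Fin d → Fin m, y < W t (gridPt a k) ω}
      = ENNReal.ofReal (gridH Q W a m t) := by
  obtain ⟨hS, hmap⟩ := hW.map_grid hα ha m ht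
  have h0 : gridPt a (fun _ : Fin d => (0 : Fin m)) = 0 := by
    ext i; simp [gridPt]
  obtain ⟨h1, h2⟩ := lintegral_exp_mul_tail (V := fun k => W t (gridPt a k))
    (hW.aemeasurable_grid ha ht) hS hmap (fun _ => 0) (by rw [h0]; exact hW.zero t ht)
  suffices h : gridH Q W a m t = expMax (gridCov α r a m t) - 1 from ⟨h, h ▸ h2⟩
  rw [gridH, integral_eq_lintegral_of_nonneg_ae (ae_of_all _ fun y =>
    mul_nonneg (Real.exp_pos y).le (gridTail_nonneg a m t y))
    (Real.measurable_exp.mul (antitone_gridTail a m t).measurable).aestronglyMeasurable]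
  rw [← ENNReal.toReal_ofReal (sub_nonneg.2 h1), ← h2]
  congr 1
  refine lintegral_congr fun y => ?_
  rw [ENNReal.ofReal_mul (Real.exp_pos y).le, gridTail, ofReal_measureReal]

/-- U need not be compact, but the matrices `gridCov` stay in a compact set, on which `expMax` is
uniformly continuous. -/
theorem IsLimitField.uniformContinuousOn_gridH (hW : IsLimitField Q U α r W) (hr : IsRFamily U r)
    (hα : 0 < α) {a : ℝ} (ha : 0 ≤ a) (m : ℕ) [NeZero m] :
    UniformContinuousOn (gridH Q W a m) U := by
  obtain ⟨B, hB⟩ := hr.exists_gridCov_mem_Icc hα a m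
  have h := (uniformContinuousOn_expMax B).comp (hr.uniformContinuousOn_gridCov hα a m)
    (fun t ht => ⟨(hW.map_grid hα ha m ht).1, hB t ht⟩)
  have h2 : UniformContinuousOn (fun t => expMax (gridCov α r a m t) - 1) U := by
    rw [uniformContinuousOn_iff_restrict] at h ⊢
    exact h.sub uniformContinuous_const
  exact h2.congr fun t ht => (hW.expMax_gridCov hα ha m ht).1.symm

theorem gridPt_mem_closedCube {K : ℝ} (hK : 0 ≤ K) {m : ℕ} (k : Fin d → Fin m) :
    gridPt (K / m) k ∈ closedCube (0 : EuclideanSpace ℝ (Fin d)) K := fun i => by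
  have hm : (0 : ℝ) < m := by exact_mod_cast (k i).pos
  have hk : ((k i : ℕ) : ℝ) ≤ m := by exact_mod_cast (k i).isLt.le
  simp only [gridPt, PiLp.zero_apply, zero_add]
  refine ⟨by positivity, ?_⟩
  rw [div_mul_eq_mul_div, div_le_iff₀ hm]
  gcongr

theorem IsLimitField.ofReal_gridH_le_HK (hW : IsLimitField Q U α r W) (hα : 0 < α)
    {K : ℝ} (hK : 0 ≤ K) (m : ℕ) [NeZero m] {t : EuclideanSpace ℝ (Fin d)} (ht : t ∈ U) :
    ENNReal.ofReal (gridH Q W (K / m) m t) ≤ HK Q W K t := by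
  rw [← (hW.expMax_gridCov hα (by positivity) m ht).2, HK]
  refine lintegral_mono fun y => ?_
  gcongr
  rintro ⟨k, hk⟩
  exact (EReal.coe_lt_coe_iff.2 hk).trans_le (le_iSup₂_of_le (gridPt (K / m) k)
    (gridPt_mem_closedCube hK k) le_rfl)

/-- Each point of the cube `[0, K]^d` is within `K / m` (coordinatewise) of a grid point. -/
theorem exists_gridPt_near {K : ℝ} (hK : 0 < K) (m : ℕ) [NeZero m] {u : EuclideanSpace ℝ (Fin d)}
    (hu : u ∈ closedCube (0 : EuclideanSpace ℝ (Fin d)) K) :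
    ∃ k : Fin d → Fin m, ∀ i, |gridPt (K / m) k i - u i| ≤ K / m := by
  have hm : (0 : ℝ) < m := by exact_mod_cast NeZero.pos m
  have h : ∀ i, ∃ k : Fin m, |K / m * (k : ℕ) - u i| ≤ K / m := fun i => by
    obtain ⟨h0, h1⟩ := hu i
    simp only [PiLp.zero_apply, zero_add] at h0 h1
    have ha : 0 < K / m := by positivity
    rcases h1.lt_or_eq with h1 | h1
    · have hj : ⌊u i / (K / m)⌋₊ < m := by
        rw [Nat.floor_lt (by positivity), div_lt_iff₀ ha, mul_div_cancel₀ _ hm.ne']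
        exact h1
      refine ⟨⟨_, hj⟩, ?_⟩
      have e1 := Nat.floor_le (show 0 ≤ u i / (K / m) by positivity)
      have e2 := Nat.lt_floor_add_one (u i / (K / m))
      rw [le_div_iff₀ ha] at e1
      rw [div_lt_iff₀ ha] at e2
      rw [abs_le]; constructor <;> simp only <;> linarith
    -- At the endpoint K the floor would be m, outside the grid; the last grid coordinate is still
    -- within K/m.
    · refine ⟨⟨m - 1, Nat.sub_lt (NeZero.pos m) one_pos⟩, ?_⟩
      simp only
      rw [h1, Nat.cast_pred (NeZero.pos m), mul_sub, div_mul_cancel₀ _ hm.ne', abs_le]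
      constructor
      · simp
      · simp; linarith
  choose k hk using h
  exact ⟨k, hk⟩

theorem exists_gridPt_two_pow_succ {K : ℝ} {j : ℕ} (k : Fin d → Fin (2 ^ j)) :
    ∃ l : Fin d → Fin (2 ^ (j + 1)), gridPt (K / (2 ^ (j + 1) : ℕ)) l = gridPt (K / (2 ^ j : ℕ)) k := by
  refine ⟨fun i => ⟨2 * k i, by rw [pow_succ]; omega⟩, ?_⟩
  ext i
  simp only [gridPt]
  push_cast
  field_simp
  ring

/-- By path continuity, a strict exceedance at some u persists at nearby dyadic points. The dyadic
grids are nested, so monotone convergence applies; both sides may still be infinite. -/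
theorem IsLimitField.HK_le_iSup (hW : IsLimitField Q U α r W) (hα : 0 < α)
    {K : ℝ} (hK : 0 < K) {t : EuclideanSpace ℝ (Fin d)} (ht : t ∈ U) :
    HK Q W K t ≤ ⨆ j : ℕ, ENNReal.ofReal (gridH Q W (K / (2 ^ j : ℕ)) (2 ^ j) t) := by
  let E : ℕ → ℝ → Set Ω' := fun j y =>
    {ω | ∃ k : Fin d → Fin (2 ^ j), y < W t (gridPt (K / (2 ^ j : ℕ)) k) ω}
  have hE : ∀ y, Monotone fun j => E j y := fun y => monotone_nat_of_le_succ fun j => by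
    rintro ω ⟨k, hk⟩
    obtain ⟨l, hl⟩ := exists_gridPt_two_pow_succ (K := K) k
    exact ⟨l, by rwa [hl]⟩
  have hle : ∀ y : ℝ, Q {ω | (y : EReal) < ⨆ u ∈ closedCube (0 : EuclideanSpace ℝ (Fin d)) K,
      (W t u ω : EReal)} ≤ ⨆ j, Q (E j y) := fun y => by
    rw [← (hE y).measure_iUnion]
    refine measure_mono_ae ?_
    filter_upwards [hW.cont t ht] with ω hω hy
    obtain ⟨u, hu⟩ := lt_iSup_iff.1 (show (y : EReal) < _ from hy)
    obtain ⟨hu, hyu⟩ := lt_iSup_iff.1 hu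
    have hyu : y < W t u ω := EReal.coe_lt_coe_iff.1 hyu
    have huo : u ∈ orthant d := fun i => by simpa using (hu i).1
    choose k hk using fun j : ℕ => exists_gridPt_near hK (2 ^ j) hu
    have hlim0 : Tendsto (fun j : ℕ => K / ((2 ^ j : ℕ) : ℝ)) atTop (𝓝 0) := by
      push_cast
      exact tendsto_const_nhds.div_atTop (tendsto_pow_atTop_atTop_of_one_lt one_lt_two)
    have hlim : Tendsto (fun j => gridPt (K / (2 ^ j : ℕ)) (k j)) atTop (𝓝[orthant d] u) := by
      refine tendsto_nhdsWithin_iff.2 ⟨?_, Eventually.of_forall fun j =>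
        gridPt_mem_orthant (by positivity) _⟩
      have h2 : Tendsto (fun j => (gridPt (K / (2 ^ j : ℕ)) (k j)).ofLp) atTop (𝓝 u.ofLp) := by
        refine tendsto_pi_nhds.2 fun i => ?_
        rw [tendsto_iff_norm_sub_tendsto_zero]
        exact squeeze_zero (fun _ => norm_nonneg _) (fun j => hk j i) hlim0
      exact ((PiLp.continuous_toLp 2 _).tendsto _).comp h2
    have h3 := (hω u huo).tendsto.comp hlim
    obtain ⟨j, hj⟩ := (h3.eventually_const_lt hyu).exists
    exact mem_iUnion.2 ⟨j, k j, hj⟩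
  have hmeas : ∀ j, Measurable fun y => ENNReal.ofReal (Real.exp y) * Q (E j y) := fun j => by
    refine Real.measurable_exp.ennreal_ofReal.mul (Antitone.measurable fun y z hyz => ?_)
    exact measure_mono fun ω ⟨k, hk⟩ => ⟨k, hyz.trans_lt hk⟩
  calc HK Q W K t ≤ ∫⁻ y in Ioi (0 : ℝ), ⨆ j, ENNReal.ofReal (Real.exp y) * Q (E j y) := by
        refine lintegral_mono fun y => ?_
        rw [← ENNReal.mul_iSup]
        gcongr
        exact hle y
    _ = ⨆ j, ∫⁻ y in Ioi (0 : ℝ), ENNReal.ofReal (Real.exp y) * Q (E j y) :=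
        lintegral_iSup hmeas fun i j hij y => by
          dsimp only
          gcongr
          exact hE y hij
    _ ≤ _ := iSup_mono fun j =>
        ((hW.expMax_gridCov hα (by positivity) (2 ^ j) ht).2).le

end LimitField

/-! ### From grids to cubes. -/

section Supremum

variable {d : ℕ} {Ω : Type*} [MeasurableSpace Ω] {P : Measure Ω} [IsProbabilityMeasure P]
  {Ω' : Type*} [MeasurableSpace Ω'] {Q : Measure Ω'} [IsProbabilityMeasure Q]
  {U : Set (EuclideanSpace ℝ (Fin d))} {X : ℝ → EuclideanSpace ℝ (Fin d) → Ω → ℝ}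
  {r : EuclideanSpace ℝ (Fin d) → EuclideanSpace ℝ (Fin d) → ℝ}
  {W : EuclideanSpace ℝ (Fin d) → EuclideanSpace ℝ (Fin d) → Ω' → ℝ} {α : ℝ} {L : ℝ → ℝ}

theorem DeltaWellDefined.eventually_pos (hΔ : DeltaWellDefined α L) :
    ∀ᶠ c in atTop, 0 < Delta α L c :=
  hΔ.isLeast.mono fun _ h => h.1.1

theorem cubeI_subset_closedCube (t : EuclideanSpace ℝ (Fin d)) (ζ : ℝ) :
    cubeI t ζ ⊆ closedCube t ζ := fun _ hu i => ⟨(hu i).1, (hu i).2.le⟩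

theorem add_smul_gridPt_mem_cubeI {K D : ℝ} (hK : 0 < K) (hD : 0 < D) {m : ℕ}
    (t : EuclideanSpace ℝ (Fin d)) (k : Fin d → Fin m) :
    t + D • gridPt (K / m) k ∈ cubeI t (K * D) := fun i => by
  have hm : (0 : ℝ) < m := by exact_mod_cast (k i).pos
  have hk : ((k i : ℕ) : ℝ) < m := by exact_mod_cast (k i).isLt
  simp only [gridPt, PiLp.add_apply, PiLp.smul_apply, smul_eq_mul]
  refine ⟨by simp; positivity, ?_⟩
  have : K / m * (k i : ℕ) < K := by
    rw [div_mul_eq_mul_div, div_lt_iff₀ hm]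
    gcongr
  nlinarith

theorem closedCube_cell_subset {K D : ℝ} (hK : 0 < K) (hD : 0 < D) {m : ℕ}
    (t : EuclideanSpace ℝ (Fin d)) (k : Fin d → Fin m) :
    closedCube (t + D • gridPt (K / m) k) (K / m * D) ⊆ closedCube t (K * D) := fun u hu i => by
  have hm : (0 : ℝ) < m := by exact_mod_cast (k i).pos
  have hk : ((k i : ℕ) : ℝ) + 1 ≤ m := by exact_mod_cast (k i).isLt
  have h := hu i
  simp only [gridPt, PiLp.add_apply, PiLp.smul_apply, smul_eq_mul] at h
  have h0 : 0 ≤ D * (K / m * (k i : ℕ)) := by positivity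
  have : K / m * ((k i : ℕ) + 1) ≤ K := by
    rw [div_mul_eq_mul_div, div_le_iff₀ hm]
    gcongr
  constructor
  · linarith [h.1]
  · nlinarith [h.2]

/-- Rounding down coordinatewise; as the cube is half-open, the floor stays below m. -/
theorem exists_cell_of_mem_cubeI {K D : ℝ} (hK : 0 < K) (hD : 0 < D) (m : ℕ) [NeZero m]
    {t u : EuclideanSpace ℝ (Fin d)} (hu : u ∈ cubeI t (K * D)) :
    ∃ k : Fin d → Fin m, ∃ v ∈ closedCube (0 : EuclideanSpace ℝ (Fin d)) (K / m),
      u = t + D • gridPt (K / m) k + D • v := by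
  have hm : (0 : ℝ) < m := by exact_mod_cast NeZero.pos m
  have ha : 0 < K / m := by positivity
  have h : ∀ i, ∃ k : Fin m, 0 ≤ (u i - t i) / D - K / m * (k : ℕ) ∧
      (u i - t i) / D - K / m * (k : ℕ) ≤ K / m := fun i => by
    obtain ⟨h0, h1⟩ := hu i
    have hx : 0 ≤ (u i - t i) / D := div_nonneg (by linarith) hD.le
    have hx1 : (u i - t i) / D < K := by rw [div_lt_iff₀ hD]; linarith
    have hj : ⌊(u i - t i) / D / (K / m)⌋₊ < m := by
      rw [Nat.floor_lt (by positivity), div_lt_iff₀ ha, mul_div_cancel₀ _ hm.ne']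
      exact hx1
    refine ⟨⟨_, hj⟩, ?_⟩
    have e1 := Nat.floor_le (show 0 ≤ (u i - t i) / D / (K / m) by positivity)
    have e2 := Nat.lt_floor_add_one ((u i - t i) / D / (K / m))
    rw [le_div_iff₀ ha] at e1
    rw [div_lt_iff₀ ha] at e2
    constructor <;> simp only <;> linarith
  choose k hk using h
  refine ⟨k, WithLp.toLp 2 fun i => (u i - t i) / D - K / m * (k i : ℕ), fun i => ?_, ?_⟩
  · simpa using hk i
  · ext i
    simp only [gridPt, PiLp.add_apply, PiLp.smul_apply, smul_eq_mul]
    field_simp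
    ring

theorem eventually_closedCube_subset (hU : IsOpen U) {f : ℝ → ℝ} (hf : Tendsto f atTop (𝓝 0))
    {t : EuclideanSpace ℝ (Fin d)} (ht : t ∈ U) : ∀ᶠ c in atTop, closedCube t (f c) ⊆ U := by
  have hV : IsOpen {x : Fin d → ℝ | WithLp.toLp 2 x ∈ U} :=
    hU.preimage (PiLp.continuous_toLp 2 _)
  obtain ⟨ε, hε, hball⟩ := Metric.isOpen_iff.1 hV t.ofLp ht
  filter_upwards [hf.eventually_lt_const hε] with c hc u hu
  refine hball (show u.ofLp ∈ Metric.ball t.ofLp ε from ?_)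
  rw [Metric.mem_ball, dist_pi_lt_iff hε]
  intro i
  obtain ⟨h0, h1⟩ := hu i
  rw [Real.dist_eq, abs_of_nonneg (by linarith)]
  linarith

theorem eventually_le_prob_sup (hX : IsNormalizedField P U X) (hA1 : CondA1 P U X)
    (hA2 : CondA2 P Q U X α L W) (hΔ : DeltaWellDefined α L) (hW : IsLimitField Q U α r W)
    (hr : IsRFamily U r) (hα : 0 < α) {K : ℝ} (hK : 0 < K) (m : ℕ) [NeZero m]
    {ε : ℝ} (hε : 0 < ε) : ∀ᶠ c in atTop, ∀ t ∈ U, closedCube t (K * Delta α L c) ⊆ U →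
      (1 + gridH Q W (K / m) m t - ε) * psi c
        ≤ P.real {ω | (c : EReal) < ⨆ u ∈ cubeI t (K * Delta α L c), (X c u ω : EReal)} := by
  have hm : (0 : ℝ) < m := by exact_mod_cast NeZero.pos m
  have ha : 0 < K / m := by positivity
  obtain ⟨C, hC⟩ := hW.exists_gridTail_le hr hα ha.le m
  filter_upwards [eventually_le_prob_grid hX hA1 hA2 ha
    (fun t ht k => hW.aemeasurable_grid ha.le ht k) hC hε, hΔ.eventually_pos]
    with c h1 hD t ht hcube
  have hmem := add_smul_gridPt_mem_cubeI (m := m) hK hD t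
  refine (h1 t ht fun k => hcube (cubeI_subset_closedCube _ _ (hmem k))).trans
    (measureReal_mono ?_)
  rintro ω ⟨k, hk⟩
  exact (EReal.coe_lt_coe_iff.2 hk).trans_le (le_iSup₂_of_le _ (hmem k) le_rfl)

/-- Either some grid point exceeds c - γ/c, or the cell of an exceedance has its corner at or below
that level. The second case is a union bound over m^d cells. -/
theorem eventually_prob_sup_le (hX : IsNormalizedField P U X) (hA1 : CondA1 P U X)
    (hA2 : CondA2 P Q U X α L W) (hA3 : CondA3 P U X α L)
    (hΔ : DeltaWellDefined α L) (hW : IsLimitField Q U α r W)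
    (hr : IsRFamily U r) (hα : 0 < α) {K : ℝ} (hK : 0 < K) (m : ℕ) [NeZero m]
    {n γ : ℝ} (hγ : 0 < γ) (hA4 : ∀ᶠ c in atTop, ∀ t ∈ U, closedCube t (K / m * Delta α L c) ⊆ U →
        P.real {ω | ((c : EReal) < ⨆ u ∈ closedCube (0 : EuclideanSpace ℝ (Fin d)) (K / m),
              (X c (t + Delta α L c • u) ω : EReal)) ∧ X c t ω ≤ c - γ / c} ≤ n * psi c)
    {ε : ℝ} (hε : 0 < ε) : ∀ᶠ c in atTop, ∀ t ∈ U, closedCube t (K * Delta α L c) ⊆ U →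
      P.real {ω | (c : EReal) < ⨆ u ∈ cubeI t (K * Delta α L c), (X c u ω : EReal)}
        ≤ (Real.exp γ * (1 + gridH Q W (K / m) m t) + m ^ d * n + ε) * psi c := by
  have hm : (0 : ℝ) < m := by exact_mod_cast NeZero.pos m
  have ha : 0 < K / m := by positivity
  obtain ⟨C, hC⟩ := hW.exists_gridTail_le hr hα ha.le m
  filter_upwards [eventually_prob_grid_le hX hA1 hA2 hA3 ha
    (fun t ht k => hW.aemeasurable_grid ha.le ht k) hC hγ hε, hΔ.eventually_pos, hA4]
    with c h1 hD h4 t ht hcube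
  have hmem := fun k => hcube (cubeI_subset_closedCube _ _
    (add_smul_gridPt_mem_cubeI (m := m) hK hD t k))
  have hsub : {ω | (c : EReal) < ⨆ u ∈ cubeI t (K * Delta α L c), (X c u ω : EReal)} ⊆
      {ω | ∃ k : Fin d → Fin m, c - γ / c < X c (t + Delta α L c • gridPt (K / m) k) ω} ∪
      ⋃ k ∈ (Finset.univ : Finset (Fin d → Fin m)),
        {ω | ((c : EReal) < ⨆ u ∈ closedCube (0 : EuclideanSpace ℝ (Fin d)) (K / m),
              (X c (t + Delta α L c • gridPt (K / m) k + Delta α L c • u) ω : EReal)) ∧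
          X c (t + Delta α L c • gridPt (K / m) k) ω ≤ c - γ / c} := by
    intro ω hω
    by_cases hex : ∃ k : Fin d → Fin m, c - γ / c < X c (t + Delta α L c • gridPt (K / m) k) ω
    · exact Or.inl hex
    push Not at hex
    obtain ⟨u, hu⟩ := lt_iSup_iff.1 (show (c : EReal) < _ from hω)
    obtain ⟨hu, hcu⟩ := lt_iSup_iff.1 hu
    obtain ⟨k, v, hv, rfl⟩ := exists_cell_of_mem_cubeI hK hD m hu
    exact Or.inr (mem_biUnion (Finset.mem_coe.2 (Finset.mem_univ k))
      ⟨hcu.trans_le (le_iSup₂_of_le v hv le_rfl), hex k⟩)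
  refine (measureReal_mono hsub).trans ((measureReal_union_le _ _).trans ?_)
  have s1 := h1 t ht hmem
  have s2 := (measureReal_biUnion_finset_le (μ := P) (Finset.univ : Finset (Fin d → Fin m))
    fun k => {ω | ((c : EReal) < ⨆ u ∈ closedCube (0 : EuclideanSpace ℝ (Fin d)) (K / m),
              (X c (t + Delta α L c • gridPt (K / m) k + Delta α L c • u) ω : EReal)) ∧
          X c (t + Delta α L c • gridPt (K / m) k) ω ≤ c - γ / c}).trans
    (Finset.sum_le_sum fun k _ => h4 _ (hmem k) ((closedCube_cell_subset hK hD t k).trans hcube))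
  rw [Finset.sum_const, nsmul_eq_mul, Finset.card_univ, Fintype.card_fun, Fintype.card_fin,
    Fintype.card_fin, Nat.cast_pow] at s2
  linarith

omit [IsProbabilityMeasure P] in
-- Only the value of N_a at γ_a is needed: with a = K/(m+1), o(a^d) is exactly what offsets the
-- number (m+1)^d of cells.
theorem CondA4.exists_seq (hA4 : CondA4 P U X α L) {K : ℝ} (hK : 0 < K) :
    ∃ n γ : ℕ → ℝ, (∀ m, 0 ≤ n m ∧ 0 < γ m) ∧ Tendsto γ atTop (𝓝 0) ∧
      Tendsto (fun m : ℕ => ((m + 1 : ℕ) : ℝ) ^ d * n m) atTop (𝓝 0) ∧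
      ∀ m : ℕ, ∀ᶠ c in atTop, ∀ t ∈ U, closedCube t (K / (m + 1 : ℕ) * Delta α L c) ⊆ U →
        P.real {ω | ((c : EReal) < ⨆ u ∈ closedCube (0 : EuclideanSpace ℝ (Fin d))
          (K / (m + 1 : ℕ)), (X c (t + Delta α L c • u) ω : EReal))
            ∧ X c t ω ≤ c - γ m / c} ≤ n m * psi c := by
  obtain ⟨N, g, hN, hg, hO, hbd⟩ := hA4
  have ha : ∀ m : ℕ, 0 < K / ((m + 1 : ℕ) : ℝ) := fun m => by positivity
  have hlim : Tendsto (fun m : ℕ => K / ((m + 1 : ℕ) : ℝ)) atTop (𝓝[>] 0) := by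
    refine tendsto_nhdsWithin_iff.2 ⟨?_, Eventually.of_forall ha⟩
    exact tendsto_const_nhds.div_atTop
      (tendsto_natCast_atTop_atTop.comp (tendsto_add_atTop_nat 1))
  refine ⟨fun m => N (K / (m + 1 : ℕ)) (g (K / (m + 1 : ℕ))), fun m => g (K / (m + 1 : ℕ)),
    fun m => ⟨(hN _ (ha m)).2.1 _ (hN _ (ha m)).2.2, (hN _ (ha m)).2.2⟩, hg.comp hlim, ?_,
    fun m => ?_⟩
  -- Any exponent would do, as the integral is nonnegative and is dropped.
  · have h1 := ((hO 1 one_pos).2.tendsto_div_nhds_zero.comp hlim).const_mul (K ^ d)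
    rw [mul_zero] at h1
    refine squeeze_zero (fun m => mul_nonneg (by positivity)
      ((hN _ (ha m)).2.1 _ (hN _ (ha m)).2.2)) (fun m => ?_) h1
    simp only [Function.comp_apply]
    have hI : 0 ≤ ∫ w in Ioi (1 : ℝ), w ^ 1 *
        N (K / (m + 1 : ℕ)) (g (K / (m + 1 : ℕ)) + w) := by
      refine setIntegral_nonneg measurableSet_Ioi fun w hw => ?_
      have hw : (1 : ℝ) < w := hw
      have := (hN _ (ha m)).2.2
      exact mul_nonneg (by positivity) ((hN _ (ha m)).2.1 _ (by linarith))
    rw [div_pow, div_div_eq_mul_div, mul_div_cancel₀ _ (pow_pos hK d).ne', mul_comm]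
    exact mul_le_mul_of_nonneg_right (le_add_of_nonneg_right hI) (by positivity)
  · filter_upwards [hbd _ (ha m), eventually_ge_atTop (g (K / (m + 1 : ℕ)))] with c h1 h2 t ht hcube
    exact h1 t ht hcube _ le_rfl h2

/-- The same probability is bounded below through the grid of 2^j points per side, for every j, and
above through a fixed m. Dividing by ψ(c) at one suitable c leaves an inequality on the limit field
alone, so finiteness of H_K requires no path estimate for W_t. -/
theorem HK_le_of_CondA4 (hU : IsOpen U) (hX : IsNormalizedField P U X) (hA1 : CondA1 P U X)
    (hA2 : CondA2 P Q U X α L W) (hA3 : CondA3 P U X α L)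
    (hΔ : DeltaWellDefined α L) (hW : IsLimitField Q U α r W)
    (hr : IsRFamily U r) (hα : 0 < α) {K : ℝ} (hK : 0 < K) (m : ℕ) [NeZero m]
    {n γ : ℝ} (hγ : 0 < γ) (hA4 : ∀ᶠ c in atTop, ∀ t ∈ U, closedCube t (K / m * Delta α L c) ⊆ U →
        P.real {ω | ((c : EReal) < ⨆ u ∈ closedCube (0 : EuclideanSpace ℝ (Fin d)) (K / m),
              (X c (t + Delta α L c • u) ω : EReal)) ∧ X c t ω ≤ c - γ / c} ≤ n * psi c)
    {t : EuclideanSpace ℝ (Fin d)} (ht : t ∈ U) :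
    HK Q W K t ≤ ENNReal.ofReal (Real.exp γ * (1 + gridH Q W (K / m) m t) + m ^ d * n - 1) := by
  refine (hW.HK_le_iSup hα hK ht).trans (iSup_le fun j => ENNReal.ofReal_le_ofReal ?_)
  refine le_of_forall_pos_le_add fun ε hε => ?_
  have hlim : Tendsto (fun c => K * Delta α L c) atTop (𝓝 0) := by
    simpa using hΔ.tendsto_zero.const_mul K
  obtain ⟨c, h1, h2, h3, hc⟩ :=
    ((eventually_le_prob_sup hX hA1 hA2 hΔ hW hr hα hK (2 ^ j) (half_pos hε)).and
    ((eventually_prob_sup_le hX hA1 hA2 hA3 hΔ hW hr hα hK m hγ hA4 (half_pos hε)).and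
    ((eventually_closedCube_subset hU hlim ht).and (eventually_gt_atTop 0)))).exists
  have h := le_of_mul_le_mul_right ((h1 t ht h3).trans (h2 t ht h3)) (psi_pos hc.ne')
  linarith

end Supremum

/-! ### The main theorem. -/

theorem theorem2p4 {d : ℕ} (hd : 0 < d)
    {Ω : Type*} [MeasurableSpace Ω] (P : Measure Ω) [IsProbabilityMeasure P]
    {Ω' : Type*} [MeasurableSpace Ω'] (Q : Measure Ω') [IsProbabilityMeasure Q]
    (D : Set (EuclideanSpace ℝ (Fin d))) (δ : ℝ) (hδ : 0 < δ)
    (α : ℝ) (hα : 0 < α) (hα2 : α ≤ 2)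
    (L : ℝ → ℝ) (hL : SlowlyVaryingAtZero L) (hΔ : DeltaWellDefined α L)
    (r : EuclideanSpace ℝ (Fin d) → EuclideanSpace ℝ (Fin d) → ℝ)
    (hr : IsRFamily (Metric.thickening δ D) r)
    (W : EuclideanSpace ℝ (Fin d) → EuclideanSpace ℝ (Fin d) → Ω' → ℝ)
    (hW : IsLimitField Q (Metric.thickening δ D) α r W)
    (X : ℝ → EuclideanSpace ℝ (Fin d) → Ω → ℝ)
    (hX : IsNormalizedField P (Metric.thickening δ D) X)
    (hC : CondC P (Metric.thickening δ D) X α L r)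
    (hA1 : CondA1 P (Metric.thickening δ D) X)
    (hA2 : CondA2 P Q (Metric.thickening δ D) X α L W)
    (hA3 : CondA3 P (Metric.thickening δ D) X α L)
    (hA4 : CondA4 P (Metric.thickening δ D) X α L)
    (K : ℝ) (hK : 0 < K) :
    (∀ t ∈ Metric.thickening δ D, HK Q W K t < ⊤) ∧
    UniformContinuousOn (fun t => (HK Q W K t).toReal) (Metric.thickening δ D) ∧
    ∀ ε > 0, ∀ᶠ c in atTop, ∀ t ∈ Metric.thickening δ D,
      closedCube t (K * Delta α L c) ⊆ Metric.thickening δ D →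
      |P.real {ω | (c : EReal) < ⨆ u ∈ cubeI t (K * Delta α L c), (X c u ω : EReal)}
          - psi c * (1 + (HK Q W K t).toReal)|
        ≤ ε * (psi c * (1 + (HK Q W K t).toReal)) := by
  have hU : IsOpen (Metric.thickening δ D) := Metric.isOpen_thickening
  set U := Metric.thickening δ D
  obtain ⟨n, γ, hnγ, hγ0, hρ0, hbd⟩ := hA4.exists_seq hK
  set e : ℕ → ℝ := fun m => Real.exp (γ m)
  set ρ : ℕ → ℝ := fun m => ((m + 1 : ℕ) : ℝ) ^ d * n m
  set B : ℕ → EuclideanSpace ℝ (Fin d) → ℝ := fun m => gridH Q W (K / (m + 1 : ℕ)) (m + 1)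
  have he : ∀ m, 1 ≤ e m := fun m => Real.one_le_exp (hnγ m).2.le
  have hle : ∀ m, ∀ t ∈ U, HK Q W K t ≤ ENNReal.ofReal (e m * (1 + B m t) + ρ m - 1) :=
    fun m t ht => HK_le_of_CondA4 hU hX hA1 hA2 hA3 hΔ hW hr hα hK (m + 1) (hnγ m).2 (hbd m) ht
  have hfin : ∀ t ∈ U, HK Q W K t < ⊤ := fun t ht => (hle 0 t ht).trans_lt ENNReal.ofReal_lt_top
  have hB0 : ∀ m t, 0 ≤ B m t := fun m t => gridH_nonneg _ _ _
  have hρ : ∀ m, 0 ≤ ρ m := fun m => mul_nonneg (by positivity) (hnγ m).1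
  set F : EuclideanSpace ℝ (Fin d) → ℝ := fun t => (HK Q W K t).toReal
  have hFle : ∀ m, ∀ t ∈ U, F t ≤ e m * (1 + B m t) + ρ m - 1 := fun m t ht => by
    refine ENNReal.toReal_le_of_le_ofReal ?_ (hle m t ht)
    nlinarith [he m, hB0 m t, hρ m]
  have hBF : ∀ m, ∀ t ∈ U, B m t ≤ F t := fun m t ht =>
    (ENNReal.ofReal_le_iff_le_toReal (hfin t ht).ne).1
      (hW.ofReal_gridH_le_HK hα hK.le (m + 1) ht)
  obtain ⟨C, hC⟩ := hW.exists_gridTail_le hr hα (a := K / (0 + 1 : ℕ)) (by positivity) (0 + 1)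
  set M := e 0 * (1 + C) + ρ 0 - 1
  -- The coarsest grid already bounds H_K uniformly on U.
  have hFM : ∀ t ∈ U, F t ≤ M := fun t ht => by
    refine (hFle 0 t ht).trans ?_
    have : B 0 t ≤ C := gridH_le (hC t ht)
    have := mul_le_mul_of_nonneg_left this (zero_le_one.trans (he 0))
    simp only [M]
    linarith
  -- Since B m ≤ F ≤ M, the factor e m costs at most (e m - 1)(1 + M). Hence B m ≤ F ≤ B m + τ m
  -- with τ independent of t.
  set τ : ℕ → ℝ := fun m => (e m - 1) * (1 + M) + ρ m
  have hτ : Tendsto τ atTop (𝓝 0) := by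
    have h1 : Tendsto e atTop (𝓝 (Real.exp 0)) := (Real.continuous_exp.tendsto 0).comp hγ0
    have h2 := ((h1.sub_const 1).mul_const (1 + M)).add hρ0
    simpa using h2
  have hτle : ∀ m, ∀ t ∈ U, e m * (1 + B m t) + ρ m ≤ 1 + B m t + τ m := fun m t ht => by
    have := mul_le_mul_of_nonneg_left ((hBF m t ht).trans (hFM t ht)) (sub_nonneg.2 (he m))
    simp only [τ]
    linarith
  refine ⟨hfin, Metric.uniformContinuousOn_iff.2 fun ε hε => ?_, fun ε hε => ?_⟩
  · obtain ⟨m, hm⟩ := (hτ.eventually_lt_const (show 0 < ε / 3 by positivity)).exists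
    obtain ⟨η, hη, h⟩ := Metric.uniformContinuousOn_iff.1
      (hW.uniformContinuousOn_gridH hr hα (a := K / (m + 1 : ℕ)) (by positivity) (m + 1))
      (ε / 3) (by positivity)
    refine ⟨η, hη, fun t ht s hs hts => ?_⟩
    have h1 : |B m t - B m s| < ε / 3 := h t ht s hs hts
    rw [abs_lt] at h1
    rw [Real.dist_eq]
    change |F t - F s| < ε
    rw [abs_lt]
    constructor <;>
      linarith [hBF m t ht, hBF m s hs, hFle m t ht, hFle m s hs, hτle m t ht, hτle m s hs]
  · obtain ⟨m, hm⟩ := (hτ.eventually_lt_const (half_pos hε)).exists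
    filter_upwards [eventually_le_prob_sup hX hA1 hA2 hΔ hW hr hα hK (m + 1) (half_pos hε),
      eventually_prob_sup_le hX hA1 hA2 hA3 hΔ hW hr hα hK (m + 1) (hnγ m).2 (hbd m) (half_pos hε),
      eventually_gt_atTop 0] with c h1 h2 hc t ht hcube
    have hp := psi_pos hc.ne'
    have hF0 : 0 ≤ F t := (hB0 m t).trans (hBF m t ht)
    have h3 : (1 + F t - ε) * psi c ≤ (1 + B m t - ε / 2) * psi c :=
      mul_le_mul_of_nonneg_right (by linarith [hFle m t ht, hτle m t ht]) hp.le
    have h4 : (e m * (1 + B m t) + ρ m + ε / 2) * psi c ≤ (1 + F t + ε) * psi c :=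
      mul_le_mul_of_nonneg_right (by linarith [hBF m t ht, hτle m t ht]) hp.le
    -- As F ≥ 0, the absolute error εψ(c) is also a relative error.
    have h5 : 0 ≤ ε * (psi c * F t) := by positivity
    have h1 := h3.trans (h1 t ht hcube)
    have h2 := (h2 t ht hcube).trans h4
    change |_ - psi c * (1 + F t)| ≤ ε * (psi c * (1 + F t))
    rw [abs_le]
    constructor <;> linarith
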